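/- Let $d\ge 1$ be an integer, $0<s<1$ and $p\ge q\ge 1$ be real numbers, and let $\mathbb{R}^d_+=\{x\in\mathbb{R}^d: x_d>0\}$. Assume that $\alpha,\beta\in\mathbb{R}$ satisfy $$\alpha<sq-\left(1-\tfrac qp\right),\qquad \beta<sp,\qquad \alpha>-1,\qquad \beta>-1,\qquad \alpha+\tfrac{q\beta}{p}>-1 .$$ Let $\mathcal{A}=C_c^1\big(\overline{\mathbb{R}^d_+}\big)$ if $sq-\alpha-\frac{q\beta}{p}<1$ and $\mathcal{A}=C_c^1(\mathbb{R}^d_+)$ if $sq-\alpha-\frac{q\beta}{p}>1$ (real-valued functions). Put $$\mathcal{D}=\left(\frac{\pi^{\frac{d-1}{2}}\,\Gamma\left(\frac{1+sp}{2}\right)}{\Gamma\left(\frac{d+sp}{2}\right)}\int_0^1\frac{t^{sp-1}\left(t^{-\beta}+t^{-\frac{p\alpha}{q}-\frac pq+1}\right)\left|1-t^{(1+\alpha+\frac{q\beta}{p}-sq)/q}\right|^p}{(1-t)^{1+sp}}\,dt\right)^{\frac qp}.$$ Then $\mathcal{D}<\infty$, and for every $u\in\mathcal{A}$ $$\int_{\mathbb{R}^d_+}\left(\int_{\mathbb{R}^d_+}\frac{|u(x)-u(y)|^p}{|x-y|^{d+sp}}\,y_d^{\beta}\,dy\right)^{\frac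 qp}x_d^{\alpha}\,dx\;\ge\;\mathcal{D}\int_{\mathbb{R}^d_+}\frac{|u(x)|^q}{x_d^{\,sq-\alpha-\frac{q\beta}{p}}}\,dx ,$$ where both sides are understood in $[0,\infty]$. Moreover, if $\alpha<sq-\left(1-\frac qp\right)d$ (which follows from the assumptions above when $d=1$ or $p=q$), then the constant $\mathcal{D}$ is sharp: if $C\in[0,\infty]$ is such that the inequality with $C$ in place of $\mathcal{D}$ holds for all $u\in\mathcal{A}$, then $C\le\mathcal{D}$. -/

import Mathlib

open MeasureTheory Set
open scoped ENNReal

noncomputable section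

/-- The last coordinate `x_d` of `x ∈ ℝ^d`, for `d ≥ 1`. -/
def lastCoord {d : ℕ} [NeZero d] (x : EuclideanSpace ℝ (Fin d)) : ℝ :=
  x ⟨d - 1, Nat.sub_one_lt (NeZero.ne d)⟩

/-- The open half-space `ℝ^d_+ = {x ∈ ℝ^d : x_d > 0}`. -/
def halfSpace (d : ℕ) [NeZero d] : Set (EuclideanSpace ℝ (Fin d)) :=
  {x | 0 < lastCoord x}

/-- `u` belongs to `C_c^1(Ω)`: it is continuously differentiable on `Ω` (up to the boundary points
that belong to `Ω`) and vanishes on `Ω` outside a compact subset of `Ω`. The values of `u` outside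
`Ω` play no role. -/
def IsCcOne {d : ℕ} (Ω : Set (EuclideanSpace ℝ (Fin d)))
    (u : EuclideanSpace ℝ (Fin d) → ℝ) : Prop :=
  ContDiffOn ℝ 1 u Ω ∧ ∃ K, IsCompact K ∧ K ⊆ Ω ∧ ∀ x ∈ Ω \ K, u x = 0

/-- The weighted Triebel--Lizorkin seminorm on the half-space,
`∫_{ℝ^d_+} (∫_{ℝ^d_+} |u(x) - u(y)|^p / |x - y|^{d + sp} y_d^β dy)^{q/p} x_d^α dx`,
as an element of `[0, ∞]`. -/
def tlSeminorm {d : ℕ} [NeZero d] (s p q α β : ℝ) (u : EuclideanSpace ℝ (Fin d) → ℝ) : ℝ≥0∞ :=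
  ∫⁻ x in halfSpace d,
    (∫⁻ y in halfSpace d,
      ENNReal.ofReal (|u x - u y| ^ p / ‖x - y‖ ^ ((d : ℝ) + s * p) * lastCoord y ^ β)) ^ (q / p)
    * ENNReal.ofReal (lastCoord x ^ α)

/-- The Hardy integral `∫_{ℝ^d_+} |u(x)|^q / x_d^{sq - α - qβ/p} dx`, as an element of `[0, ∞]`. -/
def hardyIntegral {d : ℕ} [NeZero d] (s p q α β : ℝ)
    (u : EuclideanSpace ℝ (Fin d) → ℝ) : ℝ≥0∞ :=
  ∫⁻ x in halfSpace d,
    ENNReal.ofReal (|u x| ^ q / lastCoord x ^ (s * q - α - q * β / p))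

/-- The constant
`(π^{(d-1)/2} Γ((1+sp)/2) / Γ((d+sp)/2) ·
  ∫_0^1 t^{sp-1} (t^{-β} + t^{-pα/q - p/q + 1}) |1 - t^{(1+α+qβ/p-sq)/q}|^p / (1-t)^{1+sp} dt)^{q/p}`,
as an element of `[0, ∞]`. -/
def hardyConst (d : ℕ) (s p q α β : ℝ) : ℝ≥0∞ :=
  (ENNReal.ofReal (Real.pi ^ (((d : ℝ) - 1) / 2) * Real.Gamma ((1 + s * p) / 2)
      / Real.Gamma (((d : ℝ) + s * p) / 2))
    * ∫⁻ t in Ioo (0 : ℝ) 1,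
      ENNReal.ofReal (t ^ (s * p - 1) * (t ^ (-β) + t ^ (-(p * α / q) - p / q + 1))
        * |1 - t ^ ((1 + α + q * β / p - s * q) / q)| ^ p / (1 - t) ^ (1 + s * p))) ^ (q / p)

end

/-! Write γ = sq - α - qβ/p and a = (1 - γ)/q. Each η in the half-space acts on it by the linear map
T_η x = x + x_d (η - e_d) (`stretch`), which multiplies the last coordinate by η_d and has
determinant η_d. For fixed x, η ↦ T_η x is a dilation by x_d followed by a translation, so y = T_η x
is a legitimate substitution in the inner integral. It turns the kernel into a fixed function k(η)
times a power of x_d, and the seminorm becomes a mixed norm of u - u ∘ T_η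
(`tlSeminorm_eq_stretch`).

Inequality. Since q ≤ p, the reverse Minkowski inequality moves the η-integral outside, leaving the
p-th powers of the norms of u - u ∘ T_η in L^q(x_d^{-γ} dx), integrated against k. The norm of u ∘
T_η is exactly η_d^{-a} times that of u, so the triangle inequality bounds each of these below by |1
- η_d^{-a}| times the norm of u. Integrating out the horizontal part of η (a Gamma-function
computation) and folding (1,∞) onto (0,1) by t ↦ 1/t turns ∫ |1 - η_d^{-a}|^p k(η) dη into the
stated constant.

Sharpness. For w = x_d^{-a} one has w ∘ T_η = η_d^{-a} w, so nothing is lost pointwise, but the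
Hardy integral of w diverges like ∫ dt/t. Truncate: u = wφ with φ = χ(x)(1 - ρ(k x_d)). From u(x) -
u(y) = φ(x)(w(x) - w(y)) + w(y)(φ(x) - φ(y)) and Minkowski, the q-th root of the seminorm of u is at
most that of the constant times the Hardy norm of u, plus an error
(`tlSeminorm_groundState_mul_le`). The error is a seminorm of φ with β replaced by b = β - ap. With
this b the outer measure is dx_d/x_d after stretching, which is dilation invariant, so the error is
bounded uniformly in k while the Hardy norm tends to infinity. The extra hypothesis on α is what
makes the seminorm of the fixed cut-off χ converge at infinity. -/

/-! ### Slicing the half-space by hyperplanes -/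

/-- The point of `ℝ^{n+1}` with last coordinate `t` and remaining coordinates `z`. -/
noncomputable def joinLast {n : ℕ} (t : ℝ) (z : EuclideanSpace ℝ (Fin n)) :
    EuclideanSpace ℝ (Fin (n + 1)) :=
  WithLp.toLp 2 ((Fin.last n).insertNth (α := fun _ => ℝ) t z.ofLp)

theorem lastCoord_joinLast {n : ℕ} (t : ℝ) (z : EuclideanSpace ℝ (Fin n)) :
    lastCoord (joinLast t z) = t := by
  change (Fin.last n).insertNth (α := fun _ => ℝ) t z.ofLp (Fin.last n) = t
  simp

theorem exists_joinLast {n : ℕ} (x : EuclideanSpace ℝ (Fin (n + 1))) :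
    ∃ z, x = joinLast (lastCoord x) z := by
  refine ⟨WithLp.toLp 2 (fun i => x ((Fin.last n).succAbove i)), ?_⟩
  ext i
  refine Fin.succAboveCases (Fin.last n) ?_ (fun j => ?_) i
  · simp only [joinLast, Fin.insertNth_apply_same]; rfl
  · simp only [joinLast, Fin.insertNth_apply_succAbove]

theorem norm_sq_joinLast_sub {n : ℕ} (t t' : ℝ) (z z' : EuclideanSpace ℝ (Fin n)) :
    ‖joinLast t z - joinLast t' z'‖ ^ 2 = (t - t') ^ 2 + ‖z - z'‖ ^ 2 := by
  rw [EuclideanSpace.norm_sq_eq, EuclideanSpace.norm_sq_eq, Fin.sum_univ_succAbove _ (Fin.last n)]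
  simp [joinLast]

theorem norm_joinLast_sub {n : ℕ} (t t' : ℝ) (z z' : EuclideanSpace ℝ (Fin n)) :
    ‖joinLast t z - joinLast t' z'‖ = √((t - t') ^ 2 + ‖z - z'‖ ^ 2) := by
  rw [← norm_sq_joinLast_sub, Real.sqrt_sq (norm_nonneg _)]

theorem measurePreserving_joinLast (n : ℕ) :
    MeasurePreserving (fun w : ℝ × EuclideanSpace ℝ (Fin n) => joinLast w.1 w.2) := by
  have h1 := (PiLp.volume_preserving_toLp (Fin (n + 1)))
  have h2 := (volume_preserving_piFinSuccAbove (fun _ : Fin (n + 1) => ℝ) (Fin.last n)).symm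
  have h3 : MeasurePreserving (Prod.map (id : ℝ → ℝ)
      (MeasurableEquiv.toLp 2 (Fin n → ℝ)).symm) (volume.prod volume) (volume.prod volume) :=
    (MeasurePreserving.id volume).prod
      (EuclideanSpace.volume_preserving_symm_measurableEquiv_toLp (Fin n))
  exact h1.comp (h2.comp h3)

theorem measurable_lastCoord {d : ℕ} [NeZero d] :
    Measurable (lastCoord : EuclideanSpace ℝ (Fin d) → ℝ) := by
  unfold lastCoord; fun_prop

theorem measurableSet_halfSpace {d : ℕ} [NeZero d] : MeasurableSet (halfSpace d) :=
  measurableSet_lt measurable_const measurable_lastCoord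

theorem lintegral_halfSpace_eq {n : ℕ} {f : EuclideanSpace ℝ (Fin (n + 1)) → ℝ≥0∞}
    (hf : Measurable f) :
    ∫⁻ x in halfSpace (n + 1), f x = ∫⁻ t in Ioi (0 : ℝ), ∫⁻ z, f (joinLast t z) := by
  have hJ := measurePreserving_joinLast n
  rw [← lintegral_indicator measurableSet_halfSpace,
    ← hJ.lintegral_comp (hf.indicator measurableSet_halfSpace),
    ← lintegral_indicator measurableSet_Ioi]
  rw [show (volume : Measure (ℝ × EuclideanSpace ℝ (Fin n))) = volume.prod volume from rfl,
    lintegral_prod (fun w => (halfSpace (n + 1)).indicator f (joinLast w.1 w.2))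
      ((hf.indicator measurableSet_halfSpace).comp hJ.measurable).aemeasurable]
  refine lintegral_congr fun t => ?_
  by_cases ht : 0 < t
  · rw [indicator_of_mem (mem_Ioi.2 ht)]
    refine lintegral_congr fun z => indicator_of_mem ?_ _
    simpa [halfSpace, lastCoord_joinLast] using ht
  · rw [indicator_of_notMem (by simpa using ht)]
    refine (lintegral_congr fun z => indicator_of_notMem ?_ _).trans lintegral_zero
    simpa [halfSpace, lastCoord_joinLast] using ht

/-! ### The horizontal integral of a power of the distance -/

theorem lintegral_rpow_mul_exp_neg_mul_Ioi {a r : ℝ} (ha : 0 < a) (hr : 0 < r) :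
    ∫⁻ t in Ioi (0 : ℝ), ENNReal.ofReal (t ^ (a - 1) * Real.exp (-(r * t)))
      = ENNReal.ofReal (r ^ (-a) * Real.Gamma a) := by
  rw [← ofReal_integral_eq_lintegral_ofReal, Real.integral_rpow_mul_exp_neg_mul_Ioi ha hr,
    one_div, Real.inv_rpow hr.le, Real.rpow_neg hr.le]
  · have := integrableOn_rpow_mul_exp_neg_mul_rpow (p := 1) (s := a - 1) (b := r) (by linarith)
      one_pos hr
    refine this.congr_fun (fun t _ => ?_) measurableSet_Ioi
    simp [neg_mul]
  · refine (ae_restrict_mem measurableSet_Ioi).mono fun t ht => ?_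
    have : (0 : ℝ) < t := ht
    positivity

theorem lintegral_exp_neg_mul_sq_norm (n : ℕ) {b : ℝ} (hb : 0 < b) :
    ∫⁻ z : EuclideanSpace ℝ (Fin n), ENNReal.ofReal (Real.exp (-(b * ‖z‖ ^ 2)))
      = ENNReal.ofReal ((Real.pi / b) ^ ((n : ℝ) / 2)) := by
  have h := GaussianFourier.integral_rexp_neg_mul_sq_norm (V := EuclideanSpace ℝ (Fin n)) hb
  rw [finrank_euclideanSpace_fin] at h
  rw [← h, ofReal_integral_eq_lintegral_ofReal]
  · simp [neg_mul]
  · by_contra hc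
    rw [integral_undef hc] at h
    have : 0 < (Real.pi / b) ^ ((n : ℝ) / 2) := by positivity
    linarith
  · exact Filter.Eventually.of_forall fun z => (Real.exp_pos _).le

/-- The constant `∫_{ℝ^n} (1 + |z|²)^{-m/2} dz`. -/
noncomputable def bracketConst (n : ℕ) (m : ℝ) : ℝ :=
  Real.pi ^ ((n : ℝ) / 2) * Real.Gamma ((m - n) / 2) / Real.Gamma (m / 2)

/-- Subordination: A^{-m/2} is Γ(m/2)⁻¹ ∫ t^{m/2-1} e^{-tA} dt. After Tonelli the z-integral is
Gaussian, and the remaining t-integral is again a Gamma integral, now with parameter (m - n)/2;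
hence the condition n < m. -/
theorem lintegral_sqrt_add_sq_rpow_neg (n : ℕ) {m r : ℝ} (hm : n < m) (hr : 0 < r) :
    ∫⁻ z : EuclideanSpace ℝ (Fin n), ENNReal.ofReal (√(r ^ 2 + ‖z‖ ^ 2) ^ (-m))
      = ENNReal.ofReal (bracketConst n m * r ^ (n - m)) := by
  have hm0 : 0 < m := lt_of_le_of_lt (Nat.cast_nonneg n) hm
  have hG : 0 < Real.Gamma (m / 2) := Real.Gamma_pos_of_pos (by positivity)
  have hA : ∀ z : EuclideanSpace ℝ (Fin n), 0 < r ^ 2 + ‖z‖ ^ 2 := fun z => by positivity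
  have h1 : ∀ z : EuclideanSpace ℝ (Fin n),
      ENNReal.ofReal (√(r ^ 2 + ‖z‖ ^ 2) ^ (-m))
        = ENNReal.ofReal (Real.Gamma (m / 2))⁻¹ * ∫⁻ t in Ioi (0 : ℝ),
          ENNReal.ofReal (t ^ (m / 2 - 1) * Real.exp (-(r ^ 2 * t)))
            * ENNReal.ofReal (Real.exp (-(t * ‖z‖ ^ 2))) := by
    intro z
    have := lintegral_rpow_mul_exp_neg_mul_Ioi (a := m / 2) (by positivity) (hA z)
    have h2 : ∫⁻ t in Ioi (0 : ℝ),
          ENNReal.ofReal (t ^ (m / 2 - 1) * Real.exp (-(r ^ 2 * t)))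
            * ENNReal.ofReal (Real.exp (-(t * ‖z‖ ^ 2)))
        = ∫⁻ t in Ioi (0 : ℝ),
          ENNReal.ofReal (t ^ (m / 2 - 1) * Real.exp (-((r ^ 2 + ‖z‖ ^ 2) * t))) := by
      refine setLIntegral_congr_fun measurableSet_Ioi fun t ht => ?_
      have ht' : (0 : ℝ) < t := ht
      rw [← ENNReal.ofReal_mul (by positivity), mul_assoc, ← Real.exp_add]
      ring_nf
    rw [h2, this, ← ENNReal.ofReal_mul (by positivity), Real.sqrt_eq_rpow,
      ← Real.rpow_mul (hA z).le]
    congr 1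
    rw [show 1 / 2 * -m = -(m / 2) by ring]
    field_simp
  simp_rw [h1]
  rw [lintegral_const_mul' _ _ ENNReal.ofReal_ne_top, lintegral_lintegral_swap]
  · have h3 : ∀ t ∈ Ioi (0 : ℝ), ∫⁻ z : EuclideanSpace ℝ (Fin n),
          ENNReal.ofReal (t ^ (m / 2 - 1) * Real.exp (-(r ^ 2 * t)))
            * ENNReal.ofReal (Real.exp (-(t * ‖z‖ ^ 2)))
        = ENNReal.ofReal (Real.pi ^ ((n : ℝ) / 2)) *
          ENNReal.ofReal (t ^ ((m - n) / 2 - 1) * Real.exp (-(r ^ 2 * t))) := by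
      intro t ht
      have ht' : (0 : ℝ) < t := ht
      rw [lintegral_const_mul' _ _ ENNReal.ofReal_ne_top, lintegral_exp_neg_mul_sq_norm n ht',
        ← ENNReal.ofReal_mul (by positivity), ← ENNReal.ofReal_mul (by positivity)]
      congr 1
      rw [Real.div_rpow Real.pi_pos.le ht'.le,
        show (m - n) / 2 - 1 = (m / 2 - 1) - (n : ℝ) / 2 by ring, Real.rpow_sub ht' (m / 2 - 1)]
      field_simp
    rw [setLIntegral_congr_fun measurableSet_Ioi h3, lintegral_const_mul' _ _ ENNReal.ofReal_ne_top,
      lintegral_rpow_mul_exp_neg_mul_Ioi (by linarith) (by positivity),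
      ← ENNReal.ofReal_mul (by positivity), ← ENNReal.ofReal_mul (by positivity), bracketConst]
    congr 1
    rw [← Real.rpow_natCast r 2, ← Real.rpow_mul hr.le,
      show ((2 : ℕ) : ℝ) * -((m - n) / 2) = n - m by push_cast; ring]
    field_simp
  · refine Measurable.aemeasurable ?_
    simp only [Function.uncurry_def]
    fun_prop

theorem bracketConst_pos (n : ℕ) {m : ℝ} (hm : n < m) : 0 < bracketConst n m := by
  have hm0 : 0 < m := lt_of_le_of_lt (Nat.cast_nonneg n) hm
  have := Real.Gamma_pos_of_pos (s := (m - n) / 2) (by linarith)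
  have := Real.Gamma_pos_of_pos (s := m / 2) (by positivity)
  unfold bracketConst
  positivity

/-- Integrating out the horizontal variables from a power of the distance to a point. -/
theorem lintegral_halfSpace_mul_norm_rpow_neg {n : ℕ} {m : ℝ} (hm : n < m)
    (x : EuclideanSpace ℝ (Fin (n + 1))) {Φ : ℝ → ℝ≥0∞} (hΦ : Measurable Φ) :
    ∫⁻ y in halfSpace (n + 1), Φ (lastCoord y) * ENNReal.ofReal (‖x - y‖ ^ (-m))
      = ENNReal.ofReal (bracketConst n m)
        * ∫⁻ t in Ioi (0 : ℝ), Φ t * ENNReal.ofReal (|lastCoord x - t| ^ (n - m)) := by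
  rw [lintegral_halfSpace_eq, ← lintegral_const_mul' _ _ ENNReal.ofReal_ne_top]
  · obtain ⟨z₀, hz₀⟩ := exists_joinLast x
    set r := lastCoord x
    have hne : ∀ᵐ t : ℝ ∂(volume.restrict (Ioi 0)), t ≠ r :=
      ae_restrict_of_ae (Measure.ae_ne volume r)
    refine lintegral_congr_ae (hne.mono fun t ht => ?_)
    have hrt : 0 < |r - t| := abs_pos.2 (sub_ne_zero.2 ht.symm)
    simp only [lastCoord_joinLast, hz₀, norm_joinLast_sub]
    rw [lintegral_const_mul _ (by fun_prop), mul_left_comm,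
      ← ENNReal.ofReal_mul (bracketConst_pos n hm).le,
      ← lintegral_sqrt_add_sq_rpow_neg n hm hrt]
    congr 1
    simp_rw [sq_abs]
    exact lintegral_sub_left_eq_self
      (fun z => ENNReal.ofReal (√((r - t) ^ 2 + ‖z‖ ^ 2) ^ (-m))) z₀
  · exact (hΦ.comp measurable_lastCoord).mul (by fun_prop)

theorem norm_sq_joinLast {n : ℕ} (t : ℝ) (z : EuclideanSpace ℝ (Fin n)) :
    ‖joinLast t z‖ ^ 2 = t ^ 2 + ‖z‖ ^ 2 := by
  rw [EuclideanSpace.norm_sq_eq, EuclideanSpace.norm_sq_eq, Fin.sum_univ_succAbove _ (Fin.last n)]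
  simp [joinLast]

/-- The integral of a function of the last coordinate over a half-ball. -/
theorem lintegral_ball_inter_halfSpace_le {n : ℕ} (R : ℝ) {Φ : ℝ → ℝ≥0∞} (hΦ : Measurable Φ) :
    ∫⁻ x in Metric.ball 0 R ∩ halfSpace (n + 1), Φ (lastCoord x)
      ≤ volume (Metric.ball (0 : EuclideanSpace ℝ (Fin n)) R) * ∫⁻ t in Ioo (0 : ℝ) R, Φ t := by
  have hm : Measurable fun x : EuclideanSpace ℝ (Fin (n + 1)) => Φ (lastCoord x) :=
    hΦ.comp measurable_lastCoord
  rw [← setLIntegral_indicator measurableSet_ball,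
    lintegral_halfSpace_eq (hm.indicator measurableSet_ball),
    ← lintegral_const_mul _ hΦ, ← lintegral_indicator measurableSet_Ioi,
    ← lintegral_indicator measurableSet_Ioo]
  refine lintegral_mono fun t => ?_
  by_cases ht : 0 < t
  swap
  · rw [indicator_of_notMem (by simpa using ht)]; exact zero_le
  rw [indicator_of_mem (mem_Ioi.2 ht)]
  have hmem : ∀ z : EuclideanSpace ℝ (Fin n), joinLast t z ∈ Metric.ball 0 R →
      t < R ∧ z ∈ Metric.ball 0 R := by
    intro z hz
    rw [mem_ball_zero_iff] at hz ⊢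
    have hR : 0 < R := (norm_nonneg _).trans_lt hz
    have := norm_sq_joinLast t z
    have h2 : ‖joinLast t z‖ ^ 2 < R ^ 2 := by gcongr
    exact ⟨lt_of_pow_lt_pow_left₀ 2 hR.le (by nlinarith [sq_nonneg ‖z‖]),
      lt_of_pow_lt_pow_left₀ 2 hR.le (by nlinarith [sq_nonneg t])⟩
  by_cases htR : t < R
  · rw [indicator_of_mem (show t ∈ Ioo 0 R from ⟨ht, htR⟩), mul_comm, ← lintegral_indicator_const
      measurableSet_ball]
    refine lintegral_mono fun z => ?_
    by_cases hz : joinLast t z ∈ Metric.ball 0 R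
    · rw [indicator_of_mem hz, indicator_of_mem (hmem z hz).2, lastCoord_joinLast]
    · rw [indicator_of_notMem hz]; exact zero_le
  · refine (lintegral_congr fun z => indicator_of_notMem (fun h => htR (hmem z h).1) _).trans_le ?_
    simp

/-! ### Minkowski's inequalities for mixed norms -/

section Minkowski

variable {X Y : Type*} [MeasurableSpace X] [MeasurableSpace Y] {μ : Measure X} {ν : Measure Y}

/-- **Minkowski's integral inequality** -/
theorem lintegral_lintegral_rpow_le [SFinite μ] [SigmaFinite ν] {m : ℝ} (hm : 1 ≤ m)
    {h : X → Y → ℝ≥0∞} (hh : Measurable (Function.uncurry h)) :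
    (∫⁻ y, (∫⁻ x, h x y ∂μ) ^ m ∂ν) ^ (1 / m) ≤ ∫⁻ x, (∫⁻ y, h x y ^ m ∂ν) ^ (1 / m) ∂μ := by
  rcases hm.eq_or_lt with rfl | hm1
  · simp only [ENNReal.rpow_one, div_one]
    rw [lintegral_lintegral_swap]
    exact (hh.comp measurable_swap).aemeasurable
  set R := ∫⁻ x, (∫⁻ y, h x y ^ m ∂ν) ^ (1 / m) ∂μ with hR
  have hm0 : 0 < m := by linarith
  set H : Y → ℝ≥0∞ := fun y => ∫⁻ x, h x y ∂μ with hH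
  have hHm : Measurable H := hh.lintegral_prod_left
  -- The duality argument ends by cancelling a power of ∫ G^m, so this integral must be finite: H is
  -- cut off in height and in space, and the cut-off is removed by Fatou.
  let G : ℕ → Y → ℝ≥0∞ := fun n => (spanningSets ν n).indicator fun y => min (H y) n
  have hGm : ∀ n, Measurable (G n) := fun n =>
    (hHm.min measurable_const).indicator (measurableSet_spanningSets ν n)
  have hGH : ∀ n y, G n y ≤ H y := fun n y =>
    (indicator_le_self' (fun _ _ => zero_le) y).trans (min_le_left _ _)
  have hconj : m.HolderConjugate m.conjExponent := Real.HolderConjugate.conjExponent hm1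
  have hbound : ∀ n, ∫⁻ y, G n y ^ m ∂ν ≤ R ^ m := by
    intro n
    set I := ∫⁻ y, G n y ^ m ∂ν with hI
    have hIfin : I ≠ ∞ := by
      have : I ≤ (n : ℝ≥0∞) ^ m * ν (spanningSets ν n) := by
        rw [← lintegral_indicator_const (measurableSet_spanningSets ν n)]
        refine lintegral_mono fun y => ?_
        by_cases hy : y ∈ spanningSets ν n
        · simp only [G, indicator_of_mem hy]
          gcongr
          exact min_le_right _ _
        · simp [G, indicator_of_notMem hy, hm0]
      refine (this.trans_lt (ENNReal.mul_lt_top ?_ (measure_spanningSets_lt_top ν n))).ne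
      exact ENNReal.rpow_lt_top_of_nonneg hm0.le (ENNReal.natCast_ne_top n)
    -- Split G^m = G · G^{m-1}, enlarge the first factor to H = ∫ h dμ, swap the integrals and apply
    -- Hölder in y for each x.
    have h1 : I ≤ R * I ^ (1 / m.conjExponent) := by
      calc I = ∫⁻ y, G n y * G n y ^ (m - 1) ∂ν := by
            refine lintegral_congr fun y => ?_
            nth_rewrite 2 [← ENNReal.rpow_one (G n y)]
            rw [← ENNReal.rpow_add_of_nonneg _ _ zero_le_one (by linarith)]
            congr 1; ring
        _ ≤ ∫⁻ y, H y * G n y ^ (m - 1) ∂ν := by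
            refine lintegral_mono fun y => ?_
            gcongr
            exact hGH n y
        _ = ∫⁻ y, ∫⁻ x, h x y * G n y ^ (m - 1) ∂μ ∂ν := by
            refine lintegral_congr fun y => ?_
            exact (lintegral_mul_const _ (hh.comp measurable_prodMk_right)).symm
        _ = ∫⁻ x, ∫⁻ y, h x y * G n y ^ (m - 1) ∂ν ∂μ := by
            rw [lintegral_lintegral_swap]
            refine Measurable.aemeasurable ?_
            exact (hh.comp measurable_swap).mul (((hGm n).comp measurable_fst).pow_const _)
        _ ≤ ∫⁻ x, (∫⁻ y, h x y ^ m ∂ν) ^ (1 / m) * I ^ (1 / m.conjExponent) ∂μ := by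
            refine lintegral_mono fun x => ?_
            have := ENNReal.lintegral_mul_le_Lp_mul_Lq ν hconj (f := h x)
              (g := fun y => G n y ^ (m - 1)) (hh.comp measurable_prodMk_left).aemeasurable
              ((hGm n).pow_const _).aemeasurable
            refine this.trans_eq ?_
            congr 2
            refine lintegral_congr fun y => ?_
            rw [← ENNReal.rpow_mul, hconj.sub_one_mul_conj]
        _ = R * I ^ (1 / m.conjExponent) := by
            rw [lintegral_mul_const]
            exact ((hh.pow_const m).lintegral_prod_right').pow_const _
    by_cases hI0 : I = 0
    · rw [hI0]; exact zero_le
    have h2 : I = I ^ (1 / m) * I ^ (1 / m.conjExponent) := by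
      rw [← ENNReal.rpow_add _ _ hI0 hIfin, one_div, one_div, hconj.inv_add_inv_eq_one,
        ENNReal.rpow_one]
    have h3 : I ^ (1 / m) ≤ R := by
      have hne0 : I ^ (1 / m.conjExponent) ≠ 0 := by
        simp [ENNReal.rpow_eq_zero_iff, hI0, hIfin]
      have hnet : I ^ (1 / m.conjExponent) ≠ ∞ := by
        simp [ENNReal.rpow_eq_top_iff, hI0, hIfin]
      nth_rewrite 1 [h2] at h1
      exact (ENNReal.mul_le_mul_iff_left hne0 hnet).1 h1
    calc I = (I ^ (1 / m)) ^ m := by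
          rw [← ENNReal.rpow_mul, one_div, inv_mul_cancel₀ hm0.ne', ENNReal.rpow_one]
      _ ≤ R ^ m := by gcongr
  have hlim : ∀ y, Filter.Tendsto (fun n => G n y ^ m) Filter.atTop (nhds (H y ^ m)) := by
    intro y
    refine (ENNReal.continuous_rpow_const.tendsto _).comp ?_
    have h1 : Filter.Tendsto (fun n : ℕ => min (H y) (n : ℝ≥0∞)) Filter.atTop
        (nhds (min (H y) ∞)) := tendsto_const_nhds.min ENNReal.tendsto_nat_nhds_top
    rw [min_eq_left le_top] at h1
    refine h1.congr' ?_
    filter_upwards [eventually_mem_spanningSets ν y] with n hn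
    simp only [G, indicator_of_mem hn]
  have hfin : ∫⁻ y, H y ^ m ∂ν ≤ R ^ m := by
    calc ∫⁻ y, H y ^ m ∂ν = ∫⁻ y, Filter.liminf (fun n => G n y ^ m) Filter.atTop ∂ν :=
          lintegral_congr fun y => (hlim y).liminf_eq.symm
      _ ≤ Filter.liminf (fun n => ∫⁻ y, G n y ^ m ∂ν) Filter.atTop :=
          lintegral_liminf_le fun n => (hGm n).pow_const m
      _ ≤ R ^ m := Filter.liminf_le_of_le (by isBoundedDefault) fun b hb => by
          obtain ⟨n, hn⟩ := hb.exists
          exact hn.trans (hbound n)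
  calc (∫⁻ y, H y ^ m ∂ν) ^ (1 / m) ≤ (R ^ m) ^ (1 / m) := by gcongr
    _ = R := by rw [← ENNReal.rpow_mul, one_div, mul_inv_cancel₀ hm0.ne', ENNReal.rpow_one]

/-- The reverse Minkowski integral inequality for exponents `0 < r ≤ 1`. -/
theorem lintegral_lintegral_rpow_inv_le [SFinite μ] [SigmaFinite ν] {r : ℝ} (hr0 : 0 < r)
    (hr : r ≤ 1) {f : X → Y → ℝ≥0∞} (hf : Measurable (Function.uncurry f)) :
    ∫⁻ y, (∫⁻ x, f x y ^ r ∂μ) ^ (1 / r) ∂ν ≤ (∫⁻ x, (∫⁻ y, f x y ∂ν) ^ r ∂μ) ^ (1 / r) := by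
  have h := lintegral_lintegral_rpow_le (μ := μ) (ν := ν) (m := 1 / r) ((one_le_div hr0).2 hr)
    (h := fun x y => f x y ^ r) (hf.pow_const r)
  simp only [one_div_one_div, ← ENNReal.rpow_mul, mul_one_div_cancel hr0.ne',
    ENNReal.rpow_one] at h
  calc _ = ((∫⁻ y, (∫⁻ x, f x y ^ r ∂μ) ^ (1 / r) ∂ν) ^ r) ^ (1 / r) := by
        rw [← ENNReal.rpow_mul, mul_one_div_cancel hr0.ne', ENNReal.rpow_one]
    _ ≤ _ := by gcongr

/-- The weighted mixed norm `‖‖U‖_{L^p(K dy)}‖_{L^q(A dx)}`. -/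
noncomputable def mixedNorm (μ : Measure X) (ν : Measure Y) (p q : ℝ) (K : X → Y → ℝ≥0∞)
    (A : X → ℝ≥0∞) (U : X → Y → ℝ≥0∞) : ℝ≥0∞ :=
  (∫⁻ x, (∫⁻ y, U x y ^ p * K x y ∂ν) ^ (q / p) * A x ∂μ) ^ (1 / q)

/-- Minkowski in L^p(dν) for almost every x, then in L^q(dμ). The weights are absorbed as K^{1/p}
and A^{1/q}, so that only the unweighted inequalities are needed. -/
theorem mixedNorm_le_add [SFinite ν] {p q : ℝ} (hp : 1 ≤ p) (hq : 1 ≤ q) {K U V W : X → Y → ℝ≥0∞}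
    {A : X → ℝ≥0∞} (hK : Measurable (Function.uncurry K)) (hA : Measurable A)
    (hV : Measurable (Function.uncurry V)) (hW : Measurable (Function.uncurry W))
    (hU : ∀ᵐ x ∂μ, ∀ᵐ y ∂ν, U x y ≤ V x y + W x y) :
    mixedNorm μ ν p q K A U ≤ mixedNorm μ ν p q K A V + mixedNorm μ ν p q K A W := by
  have hp0 : 0 < p := by linarith
  have hq0 : 0 < q := by linarith
  have inner : ∀ {V : X → Y → ℝ≥0∞}, Measurable (Function.uncurry V) →
      Measurable fun x => (∫⁻ y, V x y ^ p * K x y ∂ν) ^ (1 / p) * A x ^ (1 / q) := by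
    intro V hV
    exact (((hV.pow_const p).mul hK).lintegral_prod_right'.pow_const _).mul (hA.pow_const _)
  have key : ∀ V : X → Y → ℝ≥0∞, mixedNorm μ ν p q K A V
      = (∫⁻ x, ((∫⁻ y, V x y ^ p * K x y ∂ν) ^ (1 / p) * A x ^ (1 / q)) ^ q ∂μ) ^ (1 / q) := by
    intro V
    unfold mixedNorm
    congr 1
    refine lintegral_congr fun x => ?_
    rw [ENNReal.mul_rpow_of_nonneg _ _ hq0.le, ← ENNReal.rpow_mul, ← ENNReal.rpow_mul,
      one_div_mul_cancel hq0.ne', ENNReal.rpow_one, one_div_mul_eq_div]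
  have rootK : ∀ (V : X → Y → ℝ≥0∞) x y, V x y ^ p * K x y = (V x y * K x y ^ (1 / p)) ^ p := by
    intro V x y
    rw [ENNReal.mul_rpow_of_nonneg _ _ hp0.le, ← ENNReal.rpow_mul, one_div_mul_cancel hp0.ne',
      ENNReal.rpow_one]
  rw [key, key, key]
  refine le_trans ?_ (ENNReal.lintegral_Lp_add_le (inner hV).aemeasurable
    (inner hW).aemeasurable hq)
  refine ENNReal.rpow_le_rpow (lintegral_mono_ae (hU.mono fun x hx => ?_)) (by positivity)
  refine ENNReal.rpow_le_rpow ?_ hq0.le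
  rw [Pi.add_apply, ← add_mul]
  refine mul_le_mul_left ?_ _
  simp_rw [rootK]
  have hKx : Measurable fun y => K x y ^ (1 / p) := (hK.comp measurable_prodMk_left).pow_const _
  refine le_trans ?_ (ENNReal.lintegral_Lp_add_le
    ((hV.comp measurable_prodMk_left).mul hKx).aemeasurable
    ((hW.comp measurable_prodMk_left).mul hKx).aemeasurable hp)
  refine ENNReal.rpow_le_rpow (lintegral_mono_ae (hx.mono fun y hy => ?_)) (by positivity)
  refine ENNReal.rpow_le_rpow ?_ hp0.le
  refine (mul_le_mul_left hy (K x y ^ (1 / p))).trans_eq ?_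
  simp [add_mul]

end Minkowski

/-! ### One-dimensional integrals and the constant -/

/-- Lets comparable quantities replace each other inside a power without knowing the sign of the
exponent. -/
theorem rpow_le_mul_rpow_of_comparable {x y K c : ℝ} (hx : 0 < x) (hK : 1 ≤ K) (h1 : x ≤ K * y)
    (h2 : y ≤ K * x) : y ^ c ≤ K ^ |c| * x ^ c := by
  have hK0 : 0 < K := by linarith
  have hy : 0 < y := by
    by_contra h
    nlinarith
  rcases le_total 0 c with hc | hc
  · rw [abs_of_nonneg hc, ← Real.mul_rpow hK0.le hx.le]
    exact Real.rpow_le_rpow hy.le h2 hc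
  · rw [abs_of_nonpos hc, Real.rpow_neg hK0.le, ← Real.inv_rpow hK0.le,
      ← Real.mul_rpow (by positivity) hx.le]
    refine Real.rpow_le_rpow_of_nonpos (by positivity) ?_ hc
    rw [inv_mul_le_iff₀ hK0]
    exact h1

theorem lintegral_Ioo_rpow_lt_top {b R : ℝ} (hb : -1 < b) :
    ∫⁻ t in Ioo (0 : ℝ) R, ENNReal.ofReal (t ^ b) < ∞ := by
  rcases le_total R 0 with hR | hR
  · simp [Ioo_eq_empty_of_le hR]
  · have h := intervalIntegral.intervalIntegrable_rpow' (a := 0) (b := R) hb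
    rw [intervalIntegrable_iff_integrableOn_Ioo_of_le hR] at h
    exact h.lintegral_lt_top

theorem lintegral_Ioi_rpow_lt_top {b R : ℝ} (hb : b < -1) (hR : 0 < R) :
    ∫⁻ t in Ioi R, ENNReal.ofReal (t ^ b) < ∞ :=
  (integrableOn_Ioi_rpow_of_lt hb hR).lintegral_lt_top

theorem setLIntegral_lt_top_of_le_const_mul {X : Type*} [MeasurableSpace X] {μ : Measure X}
    {s : Set X} {f g : X → ℝ} (hs : MeasurableSet s) {C : ℝ} (hC : 0 ≤ C)
    (h : ∀ t ∈ s, f t ≤ C * g t) (hg : ∫⁻ t in s, ENNReal.ofReal (g t) ∂μ < ∞) :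
    ∫⁻ t in s, ENNReal.ofReal (f t) ∂μ < ∞ := by
  refine lt_of_le_of_lt ?_ (ENNReal.mul_lt_top (ENNReal.ofReal_lt_top (r := C)) hg)
  rw [← lintegral_const_mul' _ _ ENNReal.ofReal_ne_top]
  refine setLIntegral_mono' hs fun t ht => ?_
  rw [← ENNReal.ofReal_mul hC]
  exact ENNReal.ofReal_le_ofReal (h t ht)

theorem lintegral_abs_rpow_lt_top {c R : ℝ} (hc : -1 < c) :
    ∫⁻ t in Ioo (-R) R, ENNReal.ofReal (|t| ^ c) < ∞ := by
  have hpos : ∫⁻ t in Ioo 0 R, ENNReal.ofReal (|t| ^ c) < ∞ :=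
    setLIntegral_lt_top_of_le_const_mul measurableSet_Ioo zero_le_one
      (fun t ht => by rw [abs_of_pos ht.1, one_mul]) (lintegral_Ioo_rpow_lt_top hc)
  have hneg : ∫⁻ t in Ioo (-R) 0, ENNReal.ofReal (|t| ^ c) < ∞ := by
    have h := (Measure.measurePreserving_neg (volume : Measure ℝ)).setLIntegral_comp_preimage
      (s := Ioo 0 R) measurableSet_Ioo (f := fun t => ENNReal.ofReal (|t| ^ c)) (by fun_prop)
    simp only [abs_neg, neg_preimage, neg_Ioo, neg_zero] at h
    rw [h]; exact hpos
  have hsub : Ioo (-R) R ⊆ (Ioo (-R) 0 ∪ Ioo 0 R) ∪ {0} := by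
    intro t ht
    rcases lt_trichotomy t 0 with h | h | h
    · exact Or.inl (Or.inl ⟨ht.1, h⟩)
    · exact Or.inr h
    · exact Or.inl (Or.inr ⟨h, ht.2⟩)
  refine (lintegral_mono_set hsub).trans_lt ((lintegral_union_le _ _ _).trans_lt
    (ENNReal.add_lt_top.2 ⟨(lintegral_union_le _ _ _).trans_lt
      (ENNReal.add_lt_top.2 ⟨hneg, hpos⟩), ?_⟩))
  simp

theorem lintegral_rpow_mul_abs_one_sub_rpow_near_lt_top (b : ℝ) {c : ℝ} (hc : -1 < c) :
    ∫⁻ t in Icc (1 / 2 : ℝ) (3 / 2), ENNReal.ofReal (t ^ b * |1 - t| ^ c) < ∞ := by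
  refine setLIntegral_lt_top_of_le_const_mul measurableSet_Icc (C := 2 ^ |b|)
    (g := fun t => |1 - t| ^ c) (by positivity) (fun t ht => ?_) ?_
  · have := rpow_le_mul_rpow_of_comparable (x := 1) (y := t) (K := 2) (c := b) one_pos one_le_two
      (by linarith [ht.1]) (by linarith [ht.2])
    rw [Real.one_rpow, mul_one] at this
    gcongr
  · have hmp : MeasurePreserving (fun t : ℝ => 1 - t) := Measure.measurePreserving_sub_left volume 1
    have h := hmp.setLIntegral_comp_preimage (s := Ioo (-1) 1) measurableSet_Ioo
      (f := fun t => ENNReal.ofReal (|t| ^ c)) (by fun_prop)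
    refine (lintegral_mono_set ?_).trans_lt (h.trans_lt (lintegral_abs_rpow_lt_top hc))
    intro t ht
    constructor <;> linarith [ht.1, ht.2]

theorem lintegral_rpow_mul_abs_one_sub_rpow_far_lt_top {b c : ℝ} (hb : -1 < b) (hbc : b + c < -1) :
    ∫⁻ t in Ioi (0 : ℝ) \ Icc (1 / 2 : ℝ) (3 / 2), ENNReal.ofReal (t ^ b * |1 - t| ^ c) < ∞ := by
  have hsub : Ioi (0 : ℝ) \ Icc (1 / 2 : ℝ) (3 / 2) ⊆ Ioo 0 (1 / 2) ∪ Ioi (3 / 2) := by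
    rintro t ⟨h0, h1⟩
    rw [mem_Icc, not_and_or, not_le, not_le] at h1
    exact h1.imp (fun h => ⟨h0, h⟩) id
  refine (lintegral_mono_set hsub).trans_lt ((lintegral_union_le _ _ _).trans_lt
    (ENNReal.add_lt_top.2 ⟨?_, ?_⟩))
  · refine setLIntegral_lt_top_of_le_const_mul measurableSet_Ioo (C := 2 ^ |c|)
      (g := fun t => t ^ b) (by positivity) (fun t ht => ?_) (lintegral_Ioo_rpow_lt_top hb)
    have h0 : 0 < t := ht.1
    have := rpow_le_mul_rpow_of_comparable (x := 1) (y := |1 - t|) (K := 2) (c := c) one_pos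
      one_le_two (by rw [abs_of_pos] <;> linarith [ht.2]) (by rw [abs_of_pos] <;> linarith [ht.2])
    rw [Real.one_rpow, mul_one] at this
    rw [mul_comm]
    gcongr
  · refine setLIntegral_lt_top_of_le_const_mul measurableSet_Ioi (C := 3 ^ |c|)
      (g := fun t => t ^ (b + c)) (by positivity) (fun t ht => ?_)
      (lintegral_Ioi_rpow_lt_top hbc (by norm_num))
    have ht' : 3 / 2 < t := ht
    have h0 : 0 < t := by linarith
    have := rpow_le_mul_rpow_of_comparable (x := t) (y := |1 - t|) (K := 3) (c := c) h0
      (by norm_num) (by rw [abs_of_neg] <;> linarith) (by rw [abs_of_neg] <;> linarith)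
    rw [Real.rpow_add h0, mul_left_comm]
    gcongr

theorem abs_one_sub_rpow_le (a : ℝ) {t : ℝ} (ht : t ∈ Icc (1 / 2 : ℝ) (3 / 2)) :
    |1 - t ^ a| ≤ |a| * 2 ^ |a - 1| * |1 - t| := by
  have h := (convex_Icc (1 / 2 : ℝ) (3 / 2)).norm_image_sub_le_of_norm_hasDerivWithin_le
    (f := fun x => x ^ a) (f' := fun x => a * x ^ (a - 1)) (C := |a| * 2 ^ |a - 1|)
    (fun x hx => ?_) (fun x hx => ?_) ht (show (1 : ℝ) ∈ Icc (1 / 2 : ℝ) (3 / 2) by norm_num)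
  · simpa using h
  · exact (Real.hasDerivAt_rpow_const (Or.inl (by linarith [hx.1]))).hasDerivWithinAt
  · have h0 : 0 < x := by linarith [hx.1]
    have := rpow_le_mul_rpow_of_comparable (x := 1) (y := x) (K := 2) (c := a - 1) one_pos
      one_le_two (by linarith [hx.1]) (by linarith [hx.2])
    rw [Real.one_rpow, mul_one] at this
    rw [norm_mul, Real.norm_eq_abs, Real.norm_eq_abs, abs_of_pos (Real.rpow_pos_of_pos h0 _)]
    gcongr

/-- The one-dimensional integral `∫_0^∞ |1 - t^{-a}|^p t^β |1 - t|^{-1-sp} dt`. -/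
noncomputable def profileIntegral (s p a β : ℝ) : ℝ≥0∞ :=
  ∫⁻ t in Ioi (0 : ℝ), ENNReal.ofReal (|1 - t ^ (-a)| ^ p * t ^ β * |1 - t| ^ (-(1 + s * p)))

/-- At t = 1 the numerator vanishes to order p, leaving |1 - t|^{p-1-sp}, integrable because s < 1.
Away from 1 the numerator is at most a constant times 1 + t^{-ap}, so the integrand is controlled by
the weights t^β and t^{β-ap}; each converges at 0 when its exponent exceeds -1 and at infinity when
it is below sp. -/
theorem profileIntegral_lt_top {s p a β : ℝ} (hs1 : s < 1) (hp : 1 ≤ p)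
    (hβ1 : -1 < β) (hβ : β < s * p) (hβa1 : -1 < β - a * p) (hβa : β - a * p < s * p) :
    profileIntegral s p a β < ∞ := by
  have hp0 : 0 < p := by linarith
  unfold profileIntegral
  rw [← lintegral_inter_add_sdiff _ (Ioi (0 : ℝ))
    (measurableSet_Icc (a := (1 / 2 : ℝ)) (b := 3 / 2)),
    ENNReal.add_lt_top]
  constructor
  · refine (lintegral_mono_set inter_subset_right).trans_lt ?_
    refine setLIntegral_lt_top_of_le_const_mul measurableSet_Icc
      (C := (|-a| * 2 ^ |-a - 1|) ^ p) (g := fun t => t ^ β * |1 - t| ^ (p - (1 + s * p)))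
      (by positivity) (fun t ht => ?_)
      (lintegral_rpow_mul_abs_one_sub_rpow_near_lt_top β (by nlinarith))
    have h0 : 0 < t := by linarith [ht.1]
    rcases eq_or_ne t 1 with rfl | h1
    · have : (0 : ℝ) ^ p = 0 := Real.zero_rpow hp0.ne'
      simp only [Real.one_rpow, sub_self, abs_zero, this, zero_mul]
      positivity
    have hpos : 0 < |1 - t| := abs_pos.2 (sub_ne_zero.2 h1.symm)
    calc |1 - t ^ (-a)| ^ p * t ^ β * |1 - t| ^ (-(1 + s * p))
        ≤ (|-a| * 2 ^ |-a - 1| * |1 - t|) ^ p * t ^ β * |1 - t| ^ (-(1 + s * p)) := by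
          gcongr
          exact abs_one_sub_rpow_le (-a) ht
      _ = (|-a| * 2 ^ |-a - 1|) ^ p * (t ^ β * |1 - t| ^ (p - (1 + s * p))) := by
          rw [Real.mul_rpow (by positivity) hpos.le, sub_eq_add_neg p, Real.rpow_add hpos]
          ring
  · have h1 := lintegral_rpow_mul_abs_one_sub_rpow_far_lt_top (b := β) (c := -(1 + s * p)) hβ1
      (by linarith)
    have h2 := lintegral_rpow_mul_abs_one_sub_rpow_far_lt_top (b := β - a * p)
      (c := -(1 + s * p)) hβa1 (by linarith)
    have hS : MeasurableSet (Ioi (0 : ℝ) \ Icc (1 / 2 : ℝ) (3 / 2)) :=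
      measurableSet_Ioi.diff measurableSet_Icc
    refine setLIntegral_lt_top_of_le_const_mul hS (C := 2 ^ p)
      (g := fun t => t ^ β * |1 - t| ^ (-(1 + s * p))
        + t ^ (β - a * p) * |1 - t| ^ (-(1 + s * p))) (by positivity) (fun t ht => ?_) ?_
    · have h0 : 0 < t := ht.1
      have hT : 0 < t ^ (-a) := by positivity
      have : |1 - t ^ (-a)| ^ p ≤ 2 ^ p * (1 + t ^ (-(a * p))) := by
        have e : t ^ (-(a * p)) = (t ^ (-a)) ^ p := by rw [← Real.rpow_mul h0.le]; ring_nf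
        have hm : |1 - t ^ (-a)| ≤ 2 * max 1 (t ^ (-a)) := by
          rw [abs_le]
          constructor <;> linarith [le_max_left 1 (t ^ (-a)), le_max_right 1 (t ^ (-a))]
        calc |1 - t ^ (-a)| ^ p ≤ (2 * max 1 (t ^ (-a))) ^ p := by gcongr
          _ = 2 ^ p * (max 1 (t ^ (-a))) ^ p := Real.mul_rpow (by norm_num) (by positivity)
          _ ≤ 2 ^ p * (1 + t ^ (-(a * p))) := by
            gcongr
            rw [e]
            rcases max_choice 1 (t ^ (-a)) with h | h <;> rw [h]
            · rw [Real.one_rpow]; linarith [Real.rpow_pos_of_pos hT p]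
            · linarith
      calc |1 - t ^ (-a)| ^ p * t ^ β * |1 - t| ^ (-(1 + s * p))
          ≤ 2 ^ p * (1 + t ^ (-(a * p))) * t ^ β * |1 - t| ^ (-(1 + s * p)) := by gcongr
        _ = _ := by
          rw [sub_eq_add_neg β, Real.rpow_add h0]
          ring
    · have : ∀ t ∈ Ioi (0 : ℝ) \ Icc (1 / 2 : ℝ) (3 / 2),
          ENNReal.ofReal (t ^ β * |1 - t| ^ (-(1 + s * p))
            + t ^ (β - a * p) * |1 - t| ^ (-(1 + s * p)))
          = ENNReal.ofReal (t ^ β * |1 - t| ^ (-(1 + s * p)))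
            + ENNReal.ofReal (t ^ (β - a * p) * |1 - t| ^ (-(1 + s * p))) := by
        intro t ht
        have h0 : 0 < t := ht.1
        exact ENNReal.ofReal_add (by positivity) (by positivity)
      rw [setLIntegral_congr_fun hS this, lintegral_add_left (by fun_prop), ENNReal.add_lt_top]
      exact ⟨h1, h2⟩

theorem setLIntegral_Ioi_one_eq_inv (f : ℝ → ℝ≥0∞) :
    ∫⁻ t in Ioi (1 : ℝ), f t = ∫⁻ t in Ioo (0 : ℝ) 1, ENNReal.ofReal (t ^ (-2 : ℝ)) * f t⁻¹ := by
  have himg : image (fun t : ℝ => t⁻¹) (Ioo 0 1) = Ioi 1 := by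
    ext t
    constructor
    · rintro ⟨x, hx, rfl⟩
      exact (one_lt_inv₀ hx.1).2 hx.2
    · intro ht
      have ht' : (1 : ℝ) < t := ht
      exact ⟨t⁻¹, ⟨by positivity, inv_lt_one_of_one_lt₀ ht'⟩, inv_inv t⟩
  rw [← himg, lintegral_image_eq_lintegral_abs_deriv_mul (f' := fun t => -(t ^ 2)⁻¹)
    measurableSet_Ioo (fun x hx => (hasDerivAt_inv hx.1.ne').hasDerivWithinAt)
    (inv_injective.injOn)]
  refine setLIntegral_congr_fun measurableSet_Ioo fun t ht => ?_
  have h0 : 0 < t := ht.1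
  simp only [abs_neg]
  rw [abs_of_pos (by positivity), Real.rpow_neg h0.le]
  norm_num

/-- The part over (1,∞), folded by t ↦ 1/t, yields the summand t^{-β} of the constant. The part over
(0,1) yields the other summand once t^{-ap} is pulled out of |1 - t^{-a}|^p. -/
theorem profileIntegral_eq {s p q α β : ℝ} (hq : q ≠ 0) (hp : p ≠ 0) :
    profileIntegral s p ((1 + α + q * β / p - s * q) / q) β
      = ∫⁻ t in Ioo (0 : ℝ) 1,
      ENNReal.ofReal (t ^ (s * p - 1) * (t ^ (-β) + t ^ (-(p * α / q) - p / q + 1))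
        * |1 - t ^ ((1 + α + q * β / p - s * q) / q)| ^ p / (1 - t) ^ (1 + s * p)) := by
  set a := (1 + α + q * β / p - s * q) / q with ha
  have hsplit : Ioi (0 : ℝ) =ᵐ[volume] (Ioo (0 : ℝ) 1 ∪ Ioi 1 : Set ℝ) := by
    have : Ioi (0 : ℝ) = Ioc 0 1 ∪ Ioi 1 := (Ioc_union_Ioi_eq_Ioi zero_le_one).symm
    rw [this]
    exact Ioo_ae_eq_Ioc.symm.union (ae_eq_refl _)
  unfold profileIntegral
  rw [setLIntegral_congr hsplit, lintegral_union measurableSet_Ioi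
    (disjoint_left.2 fun t h1 h2 => absurd h1.2 (not_lt.2 (le_of_lt h2))),
    setLIntegral_Ioi_one_eq_inv, ← lintegral_add_left (by fun_prop)]
  refine setLIntegral_congr_fun measurableSet_Ioo fun t ht => ?_
  have h0 : 0 < t := ht.1
  have h1 : 0 < 1 - t := by linarith [ht.2]
  have hta : 0 < t ^ a := by positivity
  have e1 : |1 - t ^ (-a)| ^ p = t ^ (-(a * p)) * |1 - t ^ a| ^ p := by
    have : 1 - t ^ (-a) = -(t ^ (-a) * (1 - t ^ a)) := by
      rw [mul_sub, ← Real.rpow_add h0]; simp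
    rw [this, abs_neg, abs_mul, abs_of_pos (by positivity), Real.mul_rpow (by positivity)
      (abs_nonneg _), ← Real.rpow_mul h0.le, neg_mul]
  have e2 : |1 - t⁻¹| ^ (-(1 + s * p)) = (1 - t) ^ (-(1 + s * p)) * t ^ (1 + s * p) := by
    have : 1 - t⁻¹ = -((1 - t) * t⁻¹) := by field_simp; ring
    rw [this, abs_neg, abs_of_pos (by positivity), Real.mul_rpow h1.le (by positivity),
      Real.inv_rpow h0.le, ← Real.rpow_neg h0.le, neg_neg]
  have e3 : t⁻¹ ^ (-a) = t ^ a := by rw [Real.inv_rpow h0.le, ← Real.rpow_neg h0.le, neg_neg]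
  have e4 : t⁻¹ ^ β = t ^ (-β) := by rw [Real.inv_rpow h0.le, ← Real.rpow_neg h0.le]
  have e5 : t ^ (s * p - 1) * t ^ (-(p * α / q) - p / q + 1) = t ^ (-(a * p)) * t ^ β := by
    rw [← Real.rpow_add h0, ← Real.rpow_add h0, ha]
    congr 1
    field_simp
    ring
  have e6 : t ^ (s * p - 1) = t ^ (-2 : ℝ) * t ^ (1 + s * p) := by
    rw [← Real.rpow_add h0]
    congr 1
    ring
  rw [← ENNReal.ofReal_mul (by positivity), ← ENNReal.ofReal_add (by positivity) (by positivity),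
    e2, e3, e4, abs_of_pos h1, div_eq_mul_inv, ← Real.rpow_neg h1.le, mul_add, e5, e6, e1]
  congr 1
  ring

theorem hardyConst_eq (n : ℕ) {s p q α β : ℝ} (hq : q ≠ 0) (hp : p ≠ 0) :
    hardyConst (n + 1) s p q α β = (ENNReal.ofReal (bracketConst n (((n + 1 : ℕ) : ℝ) + s * p))
      * profileIntegral s p ((1 + α + q * β / p - s * q) / q) β) ^ (q / p) := by
  rw [hardyConst, profileIntegral_eq hq hp, bracketConst]
  have h1 : (((n + 1 : ℕ) : ℝ) - 1) / 2 = (n : ℝ) / 2 := by push_cast; ring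
  have h2 : ((n + 1 : ℕ) : ℝ) + s * p - n = 1 + s * p := by push_cast; ring
  rw [h1, h2]

/-! ### The affine group of the half-space -/

section Affine

variable {d : ℕ} [NeZero d]

/-- The last coordinate as a linear form. -/
noncomputable def lastCoordDual (d : ℕ) [NeZero d] : Module.Dual ℝ (EuclideanSpace ℝ (Fin d)) :=
  (EuclideanSpace.proj (⟨d - 1, Nat.sub_one_lt (NeZero.ne d)⟩ : Fin d) :
    EuclideanSpace ℝ (Fin d) →L[ℝ] ℝ).toLinearMap

theorem lastCoordDual_apply (x : EuclideanSpace ℝ (Fin d)) : lastCoordDual d x = lastCoord x := rfl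

/-- The last vector of the standard basis. -/
noncomputable def lastVec (d : ℕ) [NeZero d] : EuclideanSpace ℝ (Fin d) :=
  EuclideanSpace.single ⟨d - 1, Nat.sub_one_lt (NeZero.ne d)⟩ 1

theorem lastCoord_lastVec : lastCoord (lastVec d) = 1 := by
  simp [lastCoord, lastVec]

theorem lastCoord_add (x y : EuclideanSpace ℝ (Fin d)) :
    lastCoord (x + y) = lastCoord x + lastCoord y := rfl

theorem lastCoord_sub (x y : EuclideanSpace ℝ (Fin d)) :
    lastCoord (x - y) = lastCoord x - lastCoord y := rfl

theorem lastCoord_smul (r : ℝ) (x : EuclideanSpace ℝ (Fin d)) :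
    lastCoord (r • x) = r * lastCoord x := rfl

theorem abs_lastCoord_le (x : EuclideanSpace ℝ (Fin d)) : |lastCoord x| ≤ ‖x‖ :=
  PiLp.norm_apply_le x _

/-- The linear map `x ↦ x + x_d (η - e_d)`, which sends `e_d` to `η`. -/
noncomputable def stretch (η x : EuclideanSpace ℝ (Fin d)) : EuclideanSpace ℝ (Fin d) :=
  x + lastCoord x • (η - lastVec d)

theorem lastCoord_stretch (η x : EuclideanSpace ℝ (Fin d)) :
    lastCoord (stretch η x) = lastCoord x * lastCoord η := by
  rw [stretch, lastCoord_add, lastCoord_smul, lastCoord_sub, lastCoord_lastVec]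
  ring

theorem measurable_stretch :
    Measurable fun w : EuclideanSpace ℝ (Fin d) × EuclideanSpace ℝ (Fin d) => stretch w.2 w.1 := by
  unfold stretch
  exact measurable_fst.add ((measurable_lastCoord.comp measurable_fst).smul
    (measurable_snd.sub measurable_const))

theorem stretch_mem_halfSpace_iff {η x : EuclideanSpace ℝ (Fin d)} (hη : η ∈ halfSpace d) :
    stretch η x ∈ halfSpace d ↔ x ∈ halfSpace d := by
  have h : 0 < lastCoord η := hη
  change 0 < lastCoord _ ↔ 0 < lastCoord _
  rw [lastCoord_stretch, mul_pos_iff_of_pos_right h]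

/-- For fixed η the stretching is a transvection with determinant 1 + (η_d - 1) = η_d, and it
preserves the half-space. -/
theorem lintegral_halfSpace_comp_stretch {η : EuclideanSpace ℝ (Fin d)} (hη : η ∈ halfSpace d)
    {g : EuclideanSpace ℝ (Fin d) → ℝ≥0∞} (hg : Measurable g) :
    ∫⁻ x in halfSpace d, g (stretch η x)
      = ENNReal.ofReal (lastCoord η)⁻¹ * ∫⁻ x in halfSpace d, g x := by
  have hη0 : 0 < lastCoord η := hη
  have hdet : LinearMap.det (LinearMap.transvection (lastCoordDual d) (η - lastVec d))
      = lastCoord η := by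
    rw [LinearMap.transvection.det, lastCoordDual_apply, lastCoord_sub, lastCoord_lastVec]
    ring
  have hfun : (LinearMap.transvection (lastCoordDual d) (η - lastVec d) : _ → _) = stretch η := by
    funext x
    rw [LinearMap.transvection.apply]
    rfl
  have hmap := Measure.map_linearMap_addHaar_eq_smul_addHaar
    (volume : Measure (EuclideanSpace ℝ (Fin d)))
    (f := LinearMap.transvection (lastCoordDual d) (η - lastVec d)) (by rw [hdet]; exact hη0.ne')
  rw [hdet, hfun, abs_of_pos (inv_pos.2 hη0)] at hmap
  have hm : Measurable (stretch η) := measurable_stretch.comp measurable_prodMk_right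
  rw [← lintegral_indicator measurableSet_halfSpace, ← lintegral_indicator measurableSet_halfSpace,
    ← smul_eq_mul, ← lintegral_smul_measure, ← hmap,
    lintegral_map (hg.indicator measurableSet_halfSpace) hm]
  refine lintegral_congr fun x => ?_
  by_cases hx : x ∈ halfSpace d
  · rw [indicator_of_mem hx, indicator_of_mem ((stretch_mem_halfSpace_iff hη).2 hx)]
  · rw [indicator_of_notMem hx, indicator_of_notMem (mt (stretch_mem_halfSpace_iff hη).1 hx)]

/-- For fixed x the map η ↦ (x - x_d e_d) + x_d η is a dilation followed by a translation, with
Jacobian x_d^d. -/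
theorem lintegral_halfSpace_eq_lintegral_stretch {x : EuclideanSpace ℝ (Fin d)}
    (hx : x ∈ halfSpace d) {g : EuclideanSpace ℝ (Fin d) → ℝ≥0∞} (hg : Measurable g) :
    ∫⁻ y in halfSpace d, g y
      = ENNReal.ofReal (lastCoord x ^ (d : ℝ)) * ∫⁻ η in halfSpace d, g (stretch η x) := by
  have hx0 : 0 < lastCoord x := hx
  set r := lastCoord x with hr
  have hG := hg.indicator (measurableSet_halfSpace (d := d))
  have hmap := Measure.map_addHaar_smul (volume : Measure (EuclideanSpace ℝ (Fin d))) hx0.ne'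
  rw [finrank_euclideanSpace_fin, abs_of_pos (by positivity)] at hmap
  have h1 : ∫⁻ η in halfSpace d, g (stretch η x)
      = ENNReal.ofReal (r ^ d)⁻¹ * ∫⁻ y in halfSpace d, g y := by
    rw [← lintegral_indicator measurableSet_halfSpace,
      ← lintegral_indicator measurableSet_halfSpace,
      ← lintegral_add_left_eq_self ((halfSpace d).indicator g) (x - r • lastVec d), ← smul_eq_mul,
      ← lintegral_smul_measure,
      ← hmap, lintegral_map (f := fun y => (halfSpace d).indicator g (x - r • lastVec d + y))
        (hG.comp (measurable_const_add _)) (measurable_const_smul r)]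
    refine lintegral_congr fun η => ?_
    have e : x - r • lastVec d + r • η = stretch η x := by
      rw [stretch, smul_sub]; abel
    rw [e]
    have hiff : stretch η x ∈ halfSpace d ↔ η ∈ halfSpace d := by
      change 0 < lastCoord _ ↔ 0 < lastCoord _
      rw [lastCoord_stretch, mul_pos_iff_of_pos_left hx0]
    by_cases hη : η ∈ halfSpace d
    · rw [indicator_of_mem hη, indicator_of_mem (hiff.2 hη)]
    · rw [indicator_of_notMem hη, indicator_of_notMem (mt hiff.1 hη)]
  rw [h1, ← mul_assoc, ← ENNReal.ofReal_mul (by positivity), Real.rpow_natCast,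
    mul_inv_cancel₀ (by positivity), ENNReal.ofReal_one, one_mul]

end Affine

/-! ### The Hardy inequality -/

section Hardy

variable {d : ℕ} [NeZero d]

/-- Reverse triangle inequality in [0,∞], for D the norm of a difference of functions with norms A
and cA. Finiteness of A is what allows the cancellation. -/
theorem ofReal_abs_one_sub_mul_le {A D : ℝ≥0∞} {c : ℝ} (hc : 0 ≤ c) (hA : A ≠ ∞)
    (h1 : A ≤ D + ENNReal.ofReal c * A) (h2 : ENNReal.ofReal c * A ≤ D + A) :
    ENNReal.ofReal |1 - c| * A ≤ D := by
  rcases le_total c 1 with h | h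
  · rw [abs_of_nonneg (by linarith)]
    refine (ENNReal.add_le_add_iff_right (ENNReal.mul_ne_top ENNReal.ofReal_ne_top hA)).1
      (le_trans (le_of_eq ?_) h1)
    rw [← add_mul, ← ENNReal.ofReal_add (by linarith) hc]
    simp
  · rw [abs_of_nonpos (by linarith)]
    refine (ENNReal.add_le_add_iff_right hA).1 (le_trans (le_of_eq ?_) h2)
    nth_rewrite 2 [← one_mul A]
    rw [← add_mul, ← ENNReal.ofReal_one, ← ENNReal.ofReal_add (by linarith) zero_le_one]
    congr 2
    ring

/-- The weighted `L^q` norm of `u` on the half-space, with weight `x_d^{-γ}`. -/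
noncomputable def weightedNorm (q γ : ℝ) (u : EuclideanSpace ℝ (Fin d) → ℝ) : ℝ≥0∞ :=
  (∫⁻ x in halfSpace d, ENNReal.ofReal (|u x| ^ q * lastCoord x ^ (-γ))) ^ (1 / q)

theorem weightedNorm_le_add {q γ : ℝ} (hq : 1 ≤ q) {u v w : EuclideanSpace ℝ (Fin d) → ℝ}
    (hv : Measurable v) (hw : Measurable w) (h : ∀ x, |u x| ≤ |v x| + |w x|) :
    weightedNorm q γ u ≤ weightedNorm q γ v + weightedNorm q γ w := by
  have hq0 : 0 < q := by linarith
  have hl := measurable_lastCoord (d := d)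
  have key : ∀ u : EuclideanSpace ℝ (Fin d) → ℝ, weightedNorm q γ u
      = (∫⁻ x in halfSpace d, ENNReal.ofReal (|u x| * lastCoord x ^ (-γ / q)) ^ q) ^ (1 / q) := by
    intro u
    unfold weightedNorm
    congr 1
    refine setLIntegral_congr_fun measurableSet_halfSpace fun x hx => ?_
    have hx0 : 0 < lastCoord x := hx
    rw [ENNReal.ofReal_rpow_of_nonneg (by positivity) hq0.le, Real.mul_rpow (abs_nonneg _)
      (by positivity), ← Real.rpow_mul hx0.le, div_mul_cancel₀ _ hq0.ne']
  have hm : ∀ {v : EuclideanSpace ℝ (Fin d) → ℝ}, Measurable v →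
      Measurable fun x => ENNReal.ofReal (|v x| * lastCoord x ^ (-γ / q)) := by
    intro v hv
    fun_prop
  rw [key, key, key]
  refine le_trans ?_ (ENNReal.lintegral_Lp_add_le (hm hv).aemeasurable (hm hw).aemeasurable hq)
  refine ENNReal.rpow_le_rpow (setLIntegral_mono' measurableSet_halfSpace fun x hx => ?_)
    (by positivity)
  have hx0 : 0 < lastCoord x := hx
  refine ENNReal.rpow_le_rpow ?_ hq0.le
  rw [Pi.add_apply, ← ENNReal.ofReal_add (by positivity) (by positivity), ← add_mul]
  have := h x
  exact ENNReal.ofReal_le_ofReal (by gcongr)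

/-- The determinant contributes η_d^{-1} and the weight η_d^γ; the q-th root of the product is
η_d^{-a}, which is where the exponent in the sharp constant comes from. -/
theorem weightedNorm_comp_stretch {q γ : ℝ} (hq : 0 < q) {u : EuclideanSpace ℝ (Fin d) → ℝ}
    (hu : Measurable u) {η : EuclideanSpace ℝ (Fin d)} (hη : η ∈ halfSpace d) :
    weightedNorm q γ (fun x => u (stretch η x))
      = ENNReal.ofReal (lastCoord η ^ (-((1 - γ) / q))) * weightedNorm q γ u := by
  have hη0 : 0 < lastCoord η := hη
  have hl := measurable_lastCoord (d := d)
  unfold weightedNorm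
  have h1 : ∫⁻ x in halfSpace d, ENNReal.ofReal (|u (stretch η x)| ^ q * lastCoord x ^ (-γ))
      = ENNReal.ofReal (lastCoord η ^ γ) * ∫⁻ x in halfSpace d,
        ENNReal.ofReal (|u (stretch η x)| ^ q * lastCoord (stretch η x) ^ (-γ)) := by
    rw [← lintegral_const_mul' _ _ ENNReal.ofReal_ne_top]
    refine setLIntegral_congr_fun measurableSet_halfSpace fun x hx => ?_
    have hx0 : 0 < lastCoord x := hx
    rw [lastCoord_stretch, ← ENNReal.ofReal_mul (by positivity), Real.mul_rpow hx0.le hη0.le,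
      Real.rpow_neg hη0.le]
    congr 1
    field_simp
  rw [h1, lintegral_halfSpace_comp_stretch hη
    (g := fun x => ENNReal.ofReal (|u x| ^ q * lastCoord x ^ (-γ))) (by fun_prop),
    ← mul_assoc, ← ENNReal.ofReal_mul (by positivity),
    ENNReal.mul_rpow_of_nonneg _ _ (by positivity),
    ENNReal.ofReal_rpow_of_nonneg (by positivity) (by positivity)]
  congr 2
  rw [← Real.rpow_neg_one, ← Real.rpow_add hη0, ← Real.rpow_mul hη0.le]
  congr 1
  ring

theorem hardyIntegral_eq_weightedNorm {s p q α β : ℝ} (hq : 0 < q)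
    (u : EuclideanSpace ℝ (Fin d) → ℝ) :
    hardyIntegral s p q α β u = weightedNorm q (s * q - α - q * β / p) u ^ q := by
  unfold weightedNorm hardyIntegral
  rw [← ENNReal.rpow_mul, one_div_mul_cancel hq.ne', ENNReal.rpow_one]
  refine setLIntegral_congr_fun measurableSet_halfSpace fun x hx => ?_
  have hx0 : 0 < lastCoord x := hx
  rw [div_eq_mul_inv, Real.rpow_neg hx0.le]

theorem norm_sub_stretch (η x : EuclideanSpace ℝ (Fin d)) :
    ‖x - stretch η x‖ = |lastCoord x| * ‖lastVec d - η‖ := by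
  rw [stretch, sub_add_cancel_left, norm_neg, norm_smul, Real.norm_eq_abs, norm_sub_rev]

/-- The kernel `η_d^β |e_d - η|^{-(d + sp)}` of the seminorm in stretched coordinates. -/
noncomputable def stretchKernel (s p β : ℝ) (η : EuclideanSpace ℝ (Fin d)) : ℝ :=
  lastCoord η ^ β * ‖lastVec d - η‖ ^ (-((d : ℝ) + s * p))

theorem measurable_stretchKernel (s p β : ℝ) :
    Measurable (stretchKernel (d := d) s p β) := by
  have hl := measurable_lastCoord (d := d)
  unfold stretchKernel
  fun_prop

theorem stretchKernel_nonneg (s p β : ℝ) {η : EuclideanSpace ℝ (Fin d)} (hη : η ∈ halfSpace d) :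
    0 ≤ stretchKernel s p β η := by
  have hη0 : 0 < lastCoord η := hη
  unfold stretchKernel
  positivity

theorem lintegral_kernel_eq_stretch {s p β : ℝ} {x : EuclideanSpace ℝ (Fin d)}
    (hx : x ∈ halfSpace d) {W : EuclideanSpace ℝ (Fin d) → ℝ} (hW : Measurable W) :
    ∫⁻ y in halfSpace d, ENNReal.ofReal (W y / ‖x - y‖ ^ ((d : ℝ) + s * p) * lastCoord y ^ β)
      = ENNReal.ofReal (lastCoord x ^ (β - s * p)) * ∫⁻ η in halfSpace d,
        ENNReal.ofReal (W (stretch η x) * stretchKernel s p β η) := by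
  have hl := measurable_lastCoord (d := d)
  have hx0 : 0 < lastCoord x := hx
  rw [lintegral_halfSpace_eq_lintegral_stretch hx (by fun_prop),
    ← lintegral_const_mul' _ _ ENNReal.ofReal_ne_top,
    ← lintegral_const_mul' _ _ ENNReal.ofReal_ne_top]
  refine setLIntegral_congr_fun measurableSet_halfSpace fun η hη => ?_
  have hη0 : 0 < lastCoord η := hη
  rw [← ENNReal.ofReal_mul (by positivity), ← ENNReal.ofReal_mul (by positivity),
    norm_sub_stretch, lastCoord_stretch, abs_of_pos hx0,
    div_eq_mul_inv, ← Real.rpow_neg (by positivity),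
    Real.mul_rpow hx0.le (norm_nonneg _), Real.mul_rpow hx0.le hη0.le, stretchKernel]
  congr 1
  have e : lastCoord x ^ (β - s * p)
      = lastCoord x ^ (d : ℝ) * lastCoord x ^ (-((d : ℝ) + s * p)) * lastCoord x ^ β := by
    rw [← Real.rpow_add hx0, ← Real.rpow_add hx0]
    congr 1
    ring
  rw [e]
  ring

/-- The weight x_d^α is moved inside the power q/p, where it combines with the factor x_d^{β-sp}
from the substitution to give exactly the p/q-th power of the Hardy weight. -/
theorem tlSeminorm_eq_stretch {s p q α β : ℝ} (hp : 0 < p) (hq : 0 < q)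
    {u : EuclideanSpace ℝ (Fin d) → ℝ} (hu : Measurable u) :
    tlSeminorm s p q α β u = ∫⁻ x in halfSpace d, (∫⁻ η in halfSpace d,
      ENNReal.ofReal (|u x - u (stretch η x)| ^ p * lastCoord x ^ (-(s * q - α - q * β / p) * p / q)
        * stretchKernel s p β η)) ^ (q / p) := by
  unfold tlSeminorm
  refine setLIntegral_congr_fun measurableSet_halfSpace fun x hx => ?_
  have hx0 : 0 < lastCoord x := hx
  have hA : ENNReal.ofReal (lastCoord x ^ α)
      = ENNReal.ofReal (lastCoord x ^ (α * p / q)) ^ (q / p) := by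
    rw [ENNReal.ofReal_rpow_of_nonneg (by positivity) (by positivity), ← Real.rpow_mul hx0.le]
    congr 2
    field_simp
  rw [hA, ← ENNReal.mul_rpow_of_nonneg _ _ (by positivity),
    lintegral_kernel_eq_stretch hx (W := fun y => |u x - u y| ^ p) (by fun_prop), mul_comm,
    ← mul_assoc, ← ENNReal.ofReal_mul (by positivity),
    ← lintegral_const_mul' _ _ ENNReal.ofReal_ne_top]
  congr 1
  refine setLIntegral_congr_fun measurableSet_halfSpace fun η hη => ?_
  rw [← ENNReal.ofReal_mul (by positivity), ← Real.rpow_add hx0,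
    show α * p / q + (β - s * p) = -(s * q - α - q * β / p) * p / q by field_simp; ring]
  congr 1
  ring

theorem lintegral_stretchKernel_eq {n : ℕ} {s p β : ℝ} (hs : 0 < s * p) {Φ : ℝ → ℝ}
    (hΦ : Measurable Φ) (hΦ0 : ∀ t > 0, 0 ≤ Φ t) :
    ∫⁻ η in halfSpace (n + 1), ENNReal.ofReal (Φ (lastCoord η) * stretchKernel s p β η)
      = ENNReal.ofReal (bracketConst n (((n + 1 : ℕ) : ℝ) + s * p))
        * ∫⁻ t in Ioi (0 : ℝ), ENNReal.ofReal (Φ t * t ^ β * |1 - t| ^ (-(1 + s * p))) := by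
  have h := lintegral_halfSpace_mul_norm_rpow_neg (n := n) (m := ((n + 1 : ℕ) : ℝ) + s * p)
    (by push_cast; linarith) (lastVec (n + 1)) (Φ := fun t => ENNReal.ofReal (Φ t * t ^ β))
    (by fun_prop)
  rw [lastCoord_lastVec] at h
  have e1 : ∫⁻ η in halfSpace (n + 1), ENNReal.ofReal (Φ (lastCoord η) * stretchKernel s p β η)
      = ∫⁻ y in halfSpace (n + 1), ENNReal.ofReal (Φ (lastCoord y) * lastCoord y ^ β)
        * ENNReal.ofReal (‖lastVec (n + 1) - y‖ ^ (-(((n + 1 : ℕ) : ℝ) + s * p))) := by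
    refine setLIntegral_congr_fun measurableSet_halfSpace fun η hη => ?_
    have hη0 : 0 < lastCoord η := hη
    have := hΦ0 _ hη0
    rw [← ENNReal.ofReal_mul (by positivity), stretchKernel, mul_assoc]
  rw [e1, h]
  congr 1
  refine setLIntegral_congr_fun measurableSet_Ioi fun t ht => ?_
  have ht0 : 0 < t := ht
  have := hΦ0 _ ht0
  rw [← ENNReal.ofReal_mul (by positivity)]
  congr 3
  push_cast
  ring

/-- The core of the Hardy inequality: reverse Minkowski in (x, η), then the triangle inequality for
each η separately. Beyond measurability, only finiteness of the Hardy integral is required of u. -/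
theorem hardyConst_mul_le_tlSeminorm_of_measurable {n : ℕ} {s p q α β : ℝ} (hs0 : 0 < s)
    (hq : 1 ≤ q) (hpq : q ≤ p) {u : EuclideanSpace ℝ (Fin (n + 1)) → ℝ} (hu : Measurable u)
    (hfin : hardyIntegral s p q α β u ≠ ∞) :
    hardyConst (n + 1) s p q α β * hardyIntegral s p q α β u ≤ tlSeminorm s p q α β u := by
  have hq0 : 0 < q := by linarith
  have hp0 : 0 < p := by linarith
  have hl := measurable_lastCoord (d := n + 1)
  set γ := s * q - α - q * β / p with hγ
  set a := (1 + α + q * β / p - s * q) / q with ha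
  have haγ : (1 - γ) / q = a := by rw [ha, hγ]; ring
  set A := weightedNorm q γ u with hA
  have hHA : hardyIntegral s p q α β u = A ^ q := hardyIntegral_eq_weightedNorm hq0 u
  have hAfin : A ≠ ∞ := by
    intro h
    rw [hHA, h, ENNReal.top_rpow_of_pos hq0] at hfin
    exact hfin rfl
  have hus : Measurable fun w : EuclideanSpace ℝ (Fin (n + 1)) × EuclideanSpace ℝ (Fin (n + 1)) =>
      u (stretch w.2 w.1) := hu.comp measurable_stretch
  have husη : ∀ η : EuclideanSpace ℝ (Fin (n + 1)), Measurable fun x => u (stretch η x) :=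
    fun η => hus.comp measurable_prodMk_right
  have hk := measurable_stretchKernel (d := n + 1) s p β
  -- the triangle inequality for each stretching
  have htri : ∀ η ∈ halfSpace (n + 1), ENNReal.ofReal |1 - lastCoord η ^ (-a)| * A
      ≤ weightedNorm q γ (fun x => u x - u (stretch η x)) := by
    intro η hη
    have hη0 : 0 < lastCoord η := hη
    have hc := weightedNorm_comp_stretch (γ := γ) hq0 hu hη
    rw [haγ] at hc
    refine ofReal_abs_one_sub_mul_le (by positivity) hAfin ?_ ?_
    · rw [← hc]
      refine weightedNorm_le_add hq (hu.sub (husη η)) (husη η) fun x => ?_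
      simpa using abs_add_le (u x - u (stretch η x)) (u (stretch η x))
    · rw [← hc]
      refine weightedNorm_le_add hq (hu.sub (husη η)) hu fun x => ?_
      have := abs_add_le (u (stretch η x) - u x) (u x)
      rw [abs_sub_comm] at this
      simpa using this
  -- the reverse Minkowski inequality
  have hmink := lintegral_lintegral_rpow_inv_le (μ := volume.restrict (halfSpace (n + 1)))
    (ν := volume.restrict (halfSpace (n + 1))) (r := q / p) (by positivity)
    ((div_le_one hp0).2 hpq)
    (f := fun x η => ENNReal.ofReal (|u x - u (stretch η x)| ^ p
      * lastCoord x ^ (-γ * p / q) * stretchKernel s p β η)) (by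
        refine ENNReal.measurable_ofReal.comp ?_
        exact ((((hu.comp measurable_fst).sub hus).abs.pow_const p).mul
          ((hl.comp measurable_fst).pow_const _)).mul (hk.comp measurable_snd))
  rw [← tlSeminorm_eq_stretch hp0 hq0 hu] at hmink
  have hlow : ENNReal.ofReal (bracketConst n (((n + 1 : ℕ) : ℝ) + s * p))
      * profileIntegral s p a β * A ^ p ≤ tlSeminorm s p q α β u ^ (1 / (q / p)) := by
    refine le_trans ?_ hmink
    rw [profileIntegral, ← lintegral_stretchKernel_eq (Φ := fun t => |1 - t ^ (-a)| ^ p)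
      (by positivity) (by fun_prop) (fun t _ => by positivity),
      ← lintegral_mul_const' _ _ (ENNReal.rpow_ne_top_of_nonneg hp0.le hAfin)]
    refine setLIntegral_mono' measurableSet_halfSpace fun η hη => ?_
    have hη0 : 0 < lastCoord η := hη
    have hk0 : 0 ≤ stretchKernel s p β η := by unfold stretchKernel; positivity
    have e : ∫⁻ x in halfSpace (n + 1), ENNReal.ofReal (|u x - u (stretch η x)| ^ p
        * lastCoord x ^ (-γ * p / q) * stretchKernel s p β η) ^ (q / p)
        = weightedNorm q γ (fun x => u x - u (stretch η x)) ^ q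
          * ENNReal.ofReal (stretchKernel s p β η) ^ (q / p) := by
      unfold weightedNorm
      rw [← ENNReal.rpow_mul, one_div_mul_cancel hq0.ne', ENNReal.rpow_one,
        ← lintegral_mul_const' _ _ (ENNReal.rpow_ne_top_of_nonneg (by positivity)
          ENNReal.ofReal_ne_top)]
      refine setLIntegral_congr_fun measurableSet_halfSpace fun x hx => ?_
      have hx0 : 0 < lastCoord x := hx
      simp only
      rw [ENNReal.ofReal_mul (by positivity), ENNReal.mul_rpow_of_nonneg _ _ (by positivity)]
      congr 1
      rw [ENNReal.ofReal_rpow_of_nonneg (by positivity) (by positivity),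
        Real.mul_rpow (by positivity) (by positivity), ← Real.rpow_mul (abs_nonneg _),
        ← Real.rpow_mul hx0.le]
      congr 3
      · field_simp
      · field_simp
    rw [e, ENNReal.mul_rpow_of_nonneg _ _ (by positivity), ← ENNReal.rpow_mul, ← ENNReal.rpow_mul,
      mul_one_div_cancel (by positivity), ENNReal.rpow_one,
      show q * (1 / (q / p)) = p by field_simp, ENNReal.ofReal_mul (by positivity),
      mul_right_comm, ← ENNReal.ofReal_rpow_of_nonneg (abs_nonneg _) hp0.le,
      ← ENNReal.mul_rpow_of_nonneg _ _ hp0.le]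
    gcongr
    exact htri η hη
  rw [hardyConst_eq n hq0.ne' hp0.ne', hHA]
  calc _ = (ENNReal.ofReal (bracketConst n (((n + 1 : ℕ) : ℝ) + s * p))
      * profileIntegral s p a β * A ^ p) ^ (q / p) := by
        rw [ENNReal.mul_rpow_of_nonneg _ (A ^ p) (by positivity), ← ENNReal.rpow_mul,
          mul_div_cancel₀ _ hp0.ne']
    _ ≤ (tlSeminorm s p q α β u ^ (1 / (q / p))) ^ (q / p) := by gcongr
    _ = tlSeminorm s p q α β u := by
        rw [← ENNReal.rpow_mul, one_div_mul_cancel (by positivity), ENNReal.rpow_one]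

end Hardy

/-! ### From measurable functions to the admissible class. -/

section HardyAdmissible

variable {d : ℕ} [NeZero d]

theorem tlSeminorm_congr {s p q α β : ℝ} {u v : EuclideanSpace ℝ (Fin d) → ℝ}
    (h : EqOn u v (halfSpace d)) : tlSeminorm s p q α β u = tlSeminorm s p q α β v := by
  unfold tlSeminorm
  refine setLIntegral_congr_fun measurableSet_halfSpace fun x hx => ?_
  have : ∫⁻ y in halfSpace d,
      ENNReal.ofReal (|u x - u y| ^ p / ‖x - y‖ ^ ((d : ℝ) + s * p) * lastCoord y ^ β)
      = ∫⁻ y in halfSpace d,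
      ENNReal.ofReal (|v x - v y| ^ p / ‖x - y‖ ^ ((d : ℝ) + s * p) * lastCoord y ^ β) :=
    setLIntegral_congr_fun measurableSet_halfSpace fun y hy => by rw [h hx, h hy]
  rw [this]

theorem hardyIntegral_congr {s p q α β : ℝ} {u v : EuclideanSpace ℝ (Fin d) → ℝ}
    (h : EqOn u v (halfSpace d)) : hardyIntegral s p q α β u = hardyIntegral s p q α β v := by
  unfold hardyIntegral
  exact setLIntegral_congr_fun measurableSet_halfSpace fun x hx => by rw [h hx]

theorem halfSpace_subset_of_admissible {γ : ℝ} {Ω : Set (EuclideanSpace ℝ (Fin d))}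
    (hΩ : (γ < 1 ∧ Ω = closure (halfSpace d)) ∨ (1 < γ ∧ Ω = halfSpace d)) : halfSpace d ⊆ Ω := by
  rcases hΩ with ⟨-, rfl⟩ | ⟨-, rfl⟩
  · exact subset_closure
  · exact subset_rfl

theorem continuous_lastCoord : Continuous (lastCoord : EuclideanSpace ℝ (Fin d) → ℝ) := by
  unfold lastCoord; fun_prop

/-- If γ < 1, the weight x_d^{-γ} is integrable up to the boundary on bounded sets. If γ > 1, the
support is a compact subset of the open half-space, where the weight is bounded. -/
theorem hardyIntegral_ne_top {n : ℕ} {s p q α β : ℝ} (hq : 0 < q)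
    {Ω : Set (EuclideanSpace ℝ (Fin (n + 1)))}
    (hΩ : (s * q - α - q * β / p < 1 ∧ Ω = closure (halfSpace (n + 1))) ∨
      (1 < s * q - α - q * β / p ∧ Ω = halfSpace (n + 1)))
    {u : EuclideanSpace ℝ (Fin (n + 1)) → ℝ} (hu : IsCcOne Ω u) :
    hardyIntegral s p q α β u ≠ ∞ := by
  have hHΩ := halfSpace_subset_of_admissible hΩ
  obtain ⟨hu1, K, hK, hKΩ, hu0⟩ := hu
  obtain ⟨M, hM⟩ := hK.exists_bound_of_continuousOn (hu1.continuousOn.mono hKΩ)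
  obtain ⟨R, hR⟩ := hK.isBounded.subset_ball 0
  have hbound : ∀ x ∈ halfSpace (n + 1), |u x| ≤ max M 0 := by
    intro x hx
    by_cases hxK : x ∈ K
    · exact (hM x hxK).trans (le_max_left _ _)
    · rw [hu0 x ⟨hHΩ hx, hxK⟩, abs_zero]
      exact le_max_right _ _
  set γ := s * q - α - q * β / p
  have hstep : hardyIntegral s p q α β u
      ≤ ENNReal.ofReal (max M 0 ^ q) * ∫⁻ x in K ∩ halfSpace (n + 1),
        ENNReal.ofReal (lastCoord x ^ (-γ)) := by
    unfold hardyIntegral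
    rw [← setLIntegral_indicator hK.measurableSet,
      ← lintegral_const_mul' _ _ ENNReal.ofReal_ne_top]
    refine setLIntegral_mono' measurableSet_halfSpace fun x hx => ?_
    have hx0 : 0 < lastCoord x := hx
    by_cases hxK : x ∈ K
    · rw [indicator_of_mem hxK, ← ENNReal.ofReal_mul (by positivity), Real.rpow_neg hx0.le,
        ← div_eq_mul_inv]
      have := hbound x hx
      exact ENNReal.ofReal_le_ofReal (by gcongr)
    · rw [hu0 x ⟨hHΩ hx, hxK⟩]
      simp [Real.zero_rpow hq.ne']
  refine (hstep.trans_lt (ENNReal.mul_lt_top ENNReal.ofReal_lt_top ?_)).ne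
  rcases hΩ with ⟨hγ, -⟩ | ⟨hγ, rfl⟩
  · refine (lintegral_mono_set (inter_subset_inter_left _ hR)).trans_lt
      ((lintegral_ball_inter_halfSpace_le R (Φ := fun t => ENNReal.ofReal (t ^ (-γ)))
        (by fun_prop)).trans_lt (ENNReal.mul_lt_top measure_ball_lt_top
          (lintegral_Ioo_rpow_lt_top (by linarith))))
  · have hcont : ContinuousOn (fun x : EuclideanSpace ℝ (Fin (n + 1)) => lastCoord x ^ (-γ)) K :=
      continuous_lastCoord.continuousOn.rpow_const fun x hx => Or.inl (hKΩ hx).ne'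
    obtain ⟨M', hM'⟩ := hK.exists_bound_of_continuousOn hcont
    refine (lintegral_mono_set inter_subset_left).trans_lt ?_
    refine (setLIntegral_mono' hK.measurableSet (g := fun _ => ENNReal.ofReal M')
      fun x hx => ENNReal.ofReal_le_ofReal ((le_abs_self _).trans (hM' x hx))).trans_lt ?_
    rw [setLIntegral_const]
    exact ENNReal.mul_lt_top ENNReal.ofReal_lt_top hK.measure_lt_top

theorem hardyConst_mul_le_tlSeminorm {n : ℕ} {s p q α β : ℝ} (hs0 : 0 < s)
    (hq : 1 ≤ q) (hpq : q ≤ p) {Ω : Set (EuclideanSpace ℝ (Fin (n + 1)))}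
    (hΩ : (s * q - α - q * β / p < 1 ∧ Ω = closure (halfSpace (n + 1))) ∨
      (1 < s * q - α - q * β / p ∧ Ω = halfSpace (n + 1)))
    {u : EuclideanSpace ℝ (Fin (n + 1)) → ℝ} (hu : IsCcOne Ω u) :
    hardyConst (n + 1) s p q α β * hardyIntegral s p q α β u ≤ tlSeminorm s p q α β u := by
  have hHΩ := halfSpace_subset_of_admissible hΩ
  -- The values of u off Ω are arbitrary, so u itself need not be measurable; both functionals see
  -- only its restriction to the half-space.
  have hv : EqOn u ((halfSpace (n + 1)).indicator u) (halfSpace (n + 1)) :=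
    fun x hx => (indicator_of_mem hx u).symm
  have hfin := hardyIntegral_ne_top (by linarith) hΩ hu
  rw [hardyIntegral_congr hv] at hfin ⊢
  rw [tlSeminorm_congr hv]
  refine hardyConst_mul_le_tlSeminorm_of_measurable hs0 hq hpq ?_ hfin
  classical
  rw [← piecewise_eq_indicator]
  exact (hu.1.continuousOn.mono hHΩ).measurable_piecewise continuousOn_const
    measurableSet_halfSpace

end HardyAdmissible

/-! ### Energy estimates for Lipschitz functions -/

section Energy

variable {d : ℕ} [NeZero d]

/-- The inner integral of the seminorm in stretched coordinates. -/
noncomputable def stretchEnergy (s p b : ℝ) (ψ : EuclideanSpace ℝ (Fin d) → ℝ)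
    (x : EuclideanSpace ℝ (Fin d)) : ℝ≥0∞ :=
  ∫⁻ η in halfSpace d, ENNReal.ofReal (|ψ x - ψ (stretch η x)| ^ p * stretchKernel s p b η)

/-- The relation between b and α is the critical one: all powers of x_d combine to x_d^{-1}, so
dilations act without any scaling factor. -/
theorem rpow_inner_mul_eq_stretchEnergy {s p q α b : ℝ} (hp : 0 < p) (hq : 0 < q)
    (hb : (s * p - b) * (q / p) = 1 + α) {ψ : EuclideanSpace ℝ (Fin d) → ℝ} (hψ : Measurable ψ)
    {x : EuclideanSpace ℝ (Fin d)} (hx : x ∈ halfSpace d) :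
    (∫⁻ y in halfSpace d,
      ENNReal.ofReal (|ψ x - ψ y| ^ p / ‖x - y‖ ^ ((d : ℝ) + s * p) * lastCoord y ^ b)) ^ (q / p)
        * ENNReal.ofReal (lastCoord x ^ α)
      = stretchEnergy s p b ψ x ^ (q / p) * ENNReal.ofReal (lastCoord x ^ (-1 : ℝ)) := by
  have hx0 : 0 < lastCoord x := hx
  rw [lintegral_kernel_eq_stretch hx (W := fun y => |ψ x - ψ y| ^ p) (by fun_prop),
    ENNReal.mul_rpow_of_nonneg _ _ (by positivity), mul_right_comm, mul_comm, stretchEnergy,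
    ENNReal.ofReal_rpow_of_nonneg (by positivity) (by positivity),
    ← ENNReal.ofReal_mul (by positivity), ← Real.rpow_mul hx0.le, ← Real.rpow_add hx0]
  congr 4
  linarith

theorem stretch_smul (k : ℝ) (η x : EuclideanSpace ℝ (Fin d)) :
    stretch η (k • x) = k • stretch η x := by
  rw [stretch, stretch, lastCoord_smul, smul_add, smul_smul]

theorem stretchEnergy_comp_smul (s p b k : ℝ) (ψ : EuclideanSpace ℝ (Fin d) → ℝ)
    (x : EuclideanSpace ℝ (Fin d)) :
    stretchEnergy s p b (fun y => ψ (k • y)) x = stretchEnergy s p b ψ (k • x) := by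
  simp only [stretchEnergy, stretch_smul]

/-- Interpolates between boundedness and the Lipschitz bound, giving any Hölder-type exponent κ
between 0 and p. -/
theorem rpow_le_mul_rpow_of_le_mul_min {D L r p κ : ℝ} (hD : 0 ≤ D) (hL : 0 ≤ L) (hr : 0 < r)
    (hκ : 0 ≤ κ) (hκp : κ ≤ p) (h1 : D ≤ L) (h2 : D ≤ L * r) : D ^ p ≤ L ^ p * r ^ κ := by
  have hp : 0 ≤ p := hκ.trans hκp
  have hm : 0 < min 1 r := lt_min one_pos hr
  calc D ^ p ≤ (L * min 1 r) ^ p := by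
        refine Real.rpow_le_rpow hD ?_ hp
        rcases min_choice 1 r with h | h <;> rw [h]
        · simpa using h1
        · exact h2
    _ = L ^ p * (min 1 r) ^ p := Real.mul_rpow hL hm.le
    _ ≤ L ^ p * (min 1 r) ^ κ := by
        have := Real.rpow_le_rpow_of_exponent_ge hm (min_le_left _ _) hκp
        gcongr
    _ ≤ L ^ p * r ^ κ := by
        gcongr
        exact min_le_right _ _

/-- Since |x - T_η x| = x_d |e_d - η|, smoothness of ψ produces a positive power of x_d, which makes
the energy integrable against dx_d/x_d at the boundary. -/
theorem stretchEnergy_le_of_lastCoord_le {n : ℕ} {s p b L R : ℝ} (hs0 : 0 < s) (hs1 : s < 1)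
    (hp : 1 ≤ p) (hb1 : -1 < b) (hb : b < s * p) (hL : 0 ≤ L) (hR : 0 < R)
    {ψ : EuclideanSpace ℝ (Fin (n + 1)) → ℝ} (hψ1 : ∀ x y, |ψ x - ψ y| ≤ L)
    (hψ2 : ∀ x y, |ψ x - ψ y| ≤ L * ‖x - y‖) :
    ∃ σ : ℝ, 0 < σ ∧ ∃ C : ℝ≥0∞, C ≠ ∞ ∧ ∀ x ∈ halfSpace (n + 1), lastCoord x ≤ R →
      stretchEnergy s p b ψ x ≤ C * ENNReal.ofReal (lastCoord x ^ σ) := by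
  have hp0 : 0 < p := by linarith
  have hsp : 0 < s * p := by positivity
  have hspp : s * p < p := by nlinarith
  -- Two interpolation exponents are needed. For η_d near 1, δ > sp beats the singularity at η =
  -- e_d, while δ < sp + 1 keeps the horizontal integral convergent. For η_d away from 1, σ < sp - b
  -- keeps the integral convergent as η_d → ∞. The power of x_d gained overall is the smaller one,
  -- σ.
  obtain ⟨σ, hσ0, hσ⟩ := exists_between (lt_min hsp (sub_pos.2 hb))
  obtain ⟨δ, hδ0, hδ⟩ := exists_between (lt_min hspp (lt_add_one (s * p)))
  have hσ1 := hσ.trans_le (min_le_left _ _)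
  have hσ2 := hσ.trans_le (min_le_right _ _)
  have hδ1 := hδ.trans_le (min_le_left _ _)
  have hδ2 := hδ.trans_le (min_le_right _ _)
  have hl := measurable_lastCoord (d := n + 1)
  set N := Icc (1 / 2 : ℝ) (3 / 2) with hN
  have hNm : MeasurableSet N := measurableSet_Icc
  set D : ℝ := ((n + 1 : ℕ) : ℝ) + s * p with hD
  set e := lastVec (n + 1) with he
  set Φ₁ : ℝ → ℝ≥0∞ := N.indicator fun t => ENNReal.ofReal (t ^ b) with hΦ₁
  set Φ₂ : ℝ → ℝ≥0∞ := Nᶜ.indicator fun t => ENNReal.ofReal (t ^ b) with hΦ₂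
  have hm : Measurable fun t : ℝ => ENNReal.ofReal (t ^ b) := by fun_prop
  have hΦ₁m : Measurable Φ₁ := hm.indicator hNm
  have hΦ₂m : Measurable Φ₂ := hm.indicator hNm.compl
  set I := ∫⁻ η in halfSpace (n + 1), (Φ₁ (lastCoord η) * ENNReal.ofReal (‖e - η‖ ^ (-(D - δ)))
    + Φ₂ (lastCoord η) * ENNReal.ofReal (‖e - η‖ ^ (-(D - σ)))) with hI
  have hIfin : I ≠ ∞ := by
    rw [hI, lintegral_add_left (by fun_prop), lintegral_halfSpace_mul_norm_rpow_neg _ _ hΦ₁m,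
      lintegral_halfSpace_mul_norm_rpow_neg _ _ hΦ₂m, he, lastCoord_lastVec]
    · refine (ENNReal.add_lt_top.2 ⟨ENNReal.mul_lt_top ENNReal.ofReal_lt_top ?_,
        ENNReal.mul_lt_top ENNReal.ofReal_lt_top ?_⟩).ne
      · have h := lintegral_rpow_mul_abs_one_sub_rpow_near_lt_top b (c := n - (D - δ))
          (by rw [hD]; push_cast; linarith)
        refine lt_of_le_of_lt ?_ h
        refine (setLIntegral_le_lintegral _ _).trans ?_
        rw [← lintegral_indicator measurableSet_Icc]
        refine lintegral_mono fun t => ?_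
        by_cases ht : t ∈ N
        · have ht0 : 0 < t := by linarith [ht.1]
          rw [indicator_of_mem ht, hΦ₁, indicator_of_mem ht, ENNReal.ofReal_mul (by positivity)]
        · rw [hΦ₁, indicator_of_notMem ht, zero_mul]; exact zero_le
      · have h := lintegral_rpow_mul_abs_one_sub_rpow_far_lt_top (b := b) (c := n - (D - σ)) hb1
          (by rw [hD]; push_cast; linarith)
        refine lt_of_le_of_lt ?_ h
        rw [← lintegral_indicator measurableSet_Ioi,
          ← lintegral_indicator (measurableSet_Ioi.diff measurableSet_Icc)]
        refine lintegral_mono fun t => ?_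
        by_cases ht0 : t ∈ Ioi (0 : ℝ)
        · rw [indicator_of_mem ht0]
          by_cases ht : t ∈ N
          · rw [hΦ₂, indicator_of_notMem (not_not_intro ht), zero_mul]; exact zero_le
          · have : 0 < t := ht0
            rw [hΦ₂, indicator_of_mem (mem_compl ht),
              indicator_of_mem (show t ∈ Ioi (0 : ℝ) \ Icc (1 / 2) (3 / 2) from ⟨ht0, ht⟩),
              ENNReal.ofReal_mul (by positivity)]
        · rw [indicator_of_notMem ht0]; exact zero_le
    · rw [hD]; push_cast; linarith
    · rw [hD]; push_cast; linarith
  set C₀ : ℝ := L ^ p * (1 + R ^ (δ - σ)) with hC₀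
  refine ⟨σ, hσ0, ENNReal.ofReal C₀ * I, ENNReal.mul_ne_top ENNReal.ofReal_ne_top hIfin,
    fun x hx hxR => ?_⟩
  have hx0 : 0 < lastCoord x := hx
  have hC0 : 0 ≤ C₀ := by positivity
  rw [mul_right_comm, ← ENNReal.ofReal_mul hC0, hI,
    ← lintegral_const_mul' _ _ ENNReal.ofReal_ne_top, stretchEnergy]
  refine setLIntegral_mono' measurableSet_halfSpace fun η hη => ?_
  have hη0 : 0 < lastCoord η := hη
  rcases eq_or_ne η e with rfl | hne
  · have : stretch (lastVec (n + 1)) x = x := by simp [stretch]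
    rw [he, this, sub_self, abs_zero, Real.zero_rpow hp0.ne', zero_mul, ENNReal.ofReal_zero]
    exact zero_le
  have hr : 0 < ‖e - η‖ := norm_pos_iff.2 (sub_ne_zero.2 hne.symm)
  have hstep : ∀ κ, σ ≤ κ → κ ≤ p → lastCoord x ^ (κ - σ) ≤ 1 + R ^ (δ - σ) →
      |ψ x - ψ (stretch η x)| ^ p * stretchKernel s p b η
        ≤ C₀ * lastCoord x ^ σ * (lastCoord η ^ b * ‖e - η‖ ^ (-(D - κ))) := by
    intro κ hκ hκp hxκ
    have h2 := hψ2 x (stretch η x)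
    rw [norm_sub_stretch, abs_of_pos hx0] at h2
    have h3 := rpow_le_mul_rpow_of_le_mul_min (abs_nonneg _) hL (mul_pos hx0 hr)
      (hσ0.le.trans hκ) hκp (hψ1 x (stretch η x)) h2
    have h4 : ‖e - η‖ ^ (-(D - κ)) = ‖e - η‖ ^ κ * ‖e - η‖ ^ (-D) := by
      rw [← Real.rpow_add hr]; ring_nf
    have h5 : lastCoord x ^ κ = lastCoord x ^ (κ - σ) * lastCoord x ^ σ := by
      rw [← Real.rpow_add hx0]; ring_nf
    calc |ψ x - ψ (stretch η x)| ^ p * stretchKernel s p b η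
        ≤ L ^ p * (lastCoord x * ‖e - η‖) ^ κ * stretchKernel s p b η :=
          mul_le_mul_of_nonneg_right h3 (stretchKernel_nonneg s p b hη)
      _ = L ^ p * lastCoord x ^ (κ - σ) * lastCoord x ^ σ
          * (lastCoord η ^ b * ‖e - η‖ ^ (-(D - κ))) := by
          rw [Real.mul_rpow hx0.le hr.le, h5, h4, stretchKernel]; ring
      _ ≤ _ := by rw [hC₀]; gcongr
  rw [mul_add]
  by_cases hηN : lastCoord η ∈ N
  · refine le_trans ?_ le_self_add
    rw [hΦ₁, indicator_of_mem hηN, ← ENNReal.ofReal_mul (by positivity),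
      ← ENNReal.ofReal_mul (by positivity)]
    refine ENNReal.ofReal_le_ofReal (hstep δ (by linarith) hδ1.le ?_)
    have := Real.rpow_le_rpow hx0.le hxR (show 0 ≤ δ - σ by linarith)
    linarith
  · refine le_trans ?_ le_add_self
    rw [hΦ₂, indicator_of_mem (mem_compl hηN), ← ENNReal.ofReal_mul (by positivity),
      ← ENNReal.ofReal_mul (by positivity)]
    refine ENNReal.ofReal_le_ofReal (hstep σ le_rfl (by linarith) ?_)
    rw [sub_self, Real.rpow_zero]
    have : 0 ≤ R ^ (δ - σ) := by positivity
    linarith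

theorem lintegral_Ioo_rpow_eq {b ρ : ℝ} (hb : -1 < b) (hρ : 0 ≤ ρ) :
    ∫⁻ t in Ioo (0 : ℝ) ρ, ENNReal.ofReal (t ^ b) = ENNReal.ofReal (ρ ^ (b + 1) / (b + 1)) := by
  have h := intervalIntegral.intervalIntegrable_rpow' (a := 0) (b := ρ) hb
  rw [intervalIntegrable_iff_integrableOn_Ioo_of_le hρ] at h
  rw [← ofReal_integral_eq_lintegral_ofReal h, ← integral_Ioc_eq_integral_Ioo,
    ← intervalIntegral.integral_of_le hρ, integral_rpow (Or.inl hb),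
    Real.zero_rpow (by linarith), sub_zero]
  refine (ae_restrict_mem measurableSet_Ioo).mono fun t ht => ?_
  have : 0 < t := ht.1
  positivity

/-- High above the layer where g varies, g(x_d) = 1 and only the heights x_d t < 2 contribute. There
t ≤ 1/2, so the kernel is harmless and ∫ t^b over (0, 2/x_d) gives the decay. -/
theorem stretchEnergy_vertical_le {n : ℕ} {s p b L : ℝ} (hs0 : 0 < s) (hp : 0 < p) (hb1 : -1 < b)
    (hL : 0 ≤ L) {g : ℝ → ℝ} (hg : Measurable g) (hg1 : ∀ t t', |g t - g t'| ≤ L)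
    (hg2 : ∀ t, 2 ≤ t → g t = 1) :
    ∃ C : ℝ≥0∞, C ≠ ∞ ∧ ∀ x : EuclideanSpace ℝ (Fin (n + 1)), 4 ≤ lastCoord x →
      stretchEnergy s p b (fun y => g (lastCoord y)) x
        ≤ C * ENNReal.ofReal (lastCoord x ^ (-(1 + b))) := by
  have hsp : 0 < s * p := by positivity
  set B := bracketConst n (((n + 1 : ℕ) : ℝ) + s * p) with hB
  set C₀ : ℝ := L ^ p * 2 ^ |(-(1 + s * p))| with hC₀
  refine ⟨ENNReal.ofReal B * (ENNReal.ofReal C₀ * ENNReal.ofReal (2 ^ (b + 1) / (b + 1))),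
    by finiteness, fun x hx => ?_⟩
  have hx0 : 0 < lastCoord x := by linarith
  have hb0 : 0 < b + 1 := by linarith
  have hslice := lintegral_stretchKernel_eq (n := n) (s := s) (p := p) (β := b) hsp
    (Φ := fun t => |g (lastCoord x) - g (lastCoord x * t)| ^ p) (by fun_prop)
    (fun t _ => by positivity)
  simp only [stretchEnergy, lastCoord_stretch]
  rw [hslice, mul_assoc]
  gcongr
  have hfin : ∫⁻ t in Ioi (0 : ℝ), ENNReal.ofReal (|g (lastCoord x) - g (lastCoord x * t)| ^ p
      * t ^ b * |1 - t| ^ (-(1 + s * p)))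
      ≤ ∫⁻ t in Ioo 0 (2 / lastCoord x), ENNReal.ofReal C₀ * ENNReal.ofReal (t ^ b) := by
    rw [← lintegral_indicator measurableSet_Ioi, ← lintegral_indicator measurableSet_Ioo]
    refine lintegral_mono fun t => ?_
    by_cases ht0 : t ∈ Ioi (0 : ℝ)
    swap
    · rw [indicator_of_notMem ht0]; exact zero_le
    have ht : 0 < t := ht0
    rw [indicator_of_mem ht0]
    by_cases ht2 : t < 2 / lastCoord x
    · rw [indicator_of_mem (show t ∈ Ioo 0 (2 / lastCoord x) from ⟨ht, ht2⟩),
        ← ENNReal.ofReal_mul (by positivity)]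
      refine ENNReal.ofReal_le_ofReal ?_
      have hhalf : 2 / lastCoord x ≤ 1 / 2 := by
        rw [div_le_div_iff₀ hx0 two_pos]; linarith
      have h1 := rpow_le_mul_rpow_of_comparable (x := 1) (y := |1 - t|) (K := 2)
        (c := -(1 + s * p)) one_pos one_le_two (by rw [abs_of_pos] <;> linarith)
        (by rw [abs_of_pos] <;> linarith)
      rw [Real.one_rpow, mul_one] at h1
      have h2 := Real.rpow_le_rpow (abs_nonneg _) (hg1 (lastCoord x) (lastCoord x * t)) hp.le
      calc _ ≤ L ^ p * t ^ b * 2 ^ |(-(1 + s * p))| := by gcongr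
        _ = _ := by rw [hC₀]; ring
    · have h2 : 2 ≤ lastCoord x * t := by
        rw [not_lt, div_le_iff₀ hx0] at ht2
        linarith
      rw [hg2 _ h2, hg2 _ (by linarith), sub_self, abs_zero, Real.zero_rpow hp.ne', zero_mul,
        zero_mul, ENNReal.ofReal_zero]
      exact zero_le
  refine hfin.trans (le_of_eq ?_)
  rw [lintegral_const_mul' _ _ ENNReal.ofReal_ne_top,
    lintegral_Ioo_rpow_eq hb1 (by positivity), mul_assoc]
  congr 1
  rw [← ENNReal.ofReal_mul (by positivity), Real.div_rpow two_pos.le hx0.le,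
    Real.rpow_neg hx0.le, add_comm 1 b]
  congr 1
  field_simp

end Energy

/-! ### Energy of the cut-off functions at the critical exponents. -/

section FiniteEnergy

variable {d : ℕ} [NeZero d]

theorem lintegral_Ioi_comp_mul_inv {h : ℝ → ℝ≥0∞} {k : ℝ} (hk : 0 < k) :
    ∫⁻ t in Ioi (0 : ℝ), h (k * t) * ENNReal.ofReal (t ^ (-1 : ℝ))
      = ∫⁻ t in Ioi (0 : ℝ), h t * ENNReal.ofReal (t ^ (-1 : ℝ)) := by
  have himg : image (fun t : ℝ => k * t) (Ioi 0) = Ioi 0 := by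
    rw [image_mul_left_Ioi hk, mul_zero]
  nth_rewrite 2 [← himg]
  rw [lintegral_image_eq_lintegral_abs_deriv_mul (f' := fun _ => k) measurableSet_Ioi
    (fun x _ => by simpa using ((hasDerivAt_id x).const_mul k).hasDerivWithinAt)
    (mul_right_injective₀ hk.ne').injOn]
  refine setLIntegral_congr_fun measurableSet_Ioi fun t ht => ?_
  have ht0 : 0 < t := ht
  rw [abs_of_pos hk, mul_left_comm, ← ENNReal.ofReal_mul hk.le, Real.rpow_neg_one,
    Real.rpow_neg_one, mul_inv, mul_inv_cancel_left₀ (ne_of_gt hk)]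

/-- Truncating near the boundary at any scale costs a bounded amount of energy. -/
theorem exists_lintegral_stretchEnergy_vertical_le {n : ℕ} {s p q b L : ℝ} (hs0 : 0 < s)
    (hs1 : s < 1) (hp : 1 ≤ p) (hq : 0 < q) (hb1 : -1 < b) (hb : b < s * p) (hL : 0 ≤ L)
    {g : ℝ → ℝ} (hg : Measurable g) (hg1 : ∀ t t', |g t - g t'| ≤ L)
    (hg1' : ∀ t t', |g t - g t'| ≤ L * |t - t'|) (hg2 : ∀ t, 2 ≤ t → g t = 1) (R : ℝ) :
    ∃ M : ℝ≥0∞, M ≠ ∞ ∧ ∀ k > 0, ∫⁻ x in Metric.ball 0 R ∩ halfSpace (n + 1),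
      stretchEnergy s p b (fun y => g (k * lastCoord y)) x ^ (q / p)
        * ENNReal.ofReal (lastCoord x ^ (-1 : ℝ)) ≤ M := by
  have hp0 : 0 < p := by linarith
  have hqp : 0 < q / p := by positivity
  set ψ : EuclideanSpace ℝ (Fin (n + 1)) → ℝ := fun y => g (lastCoord y) with hψ
  obtain ⟨σ, hσ, C₁, hC₁, hnear⟩ := stretchEnergy_le_of_lastCoord_le (n := n) (R := 4) hs0 hs1 hp
    hb1 hb hL (by norm_num) (ψ := ψ) (fun x y => hg1 _ _) (fun x y => (hg1' _ _).trans (by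
      have := abs_lastCoord_le (x - y)
      rw [lastCoord_sub] at this
      gcongr))
  obtain ⟨C₂, hC₂, hfar⟩ := stretchEnergy_vertical_le (n := n) hs0 hp0 hb1 hL hg hg1 hg2
  -- A majorant depending on the height alone, vanishing like a power at 0 and decaying like a power
  -- at infinity, hence integrable against dt/t.
  set h : ℝ → ℝ≥0∞ := fun t => (Iic (4 : ℝ)).indicator
      (fun t => C₁ ^ (q / p) * ENNReal.ofReal (t ^ (σ * (q / p)))) t
    + (Ioi (4 : ℝ)).indicator
      (fun t => C₂ ^ (q / p) * ENNReal.ofReal (t ^ (-(1 + b) * (q / p)))) t with hh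
  have hhm : Measurable h := by
    refine Measurable.add (Measurable.indicator (by fun_prop) measurableSet_Iic)
      (Measurable.indicator (by fun_prop) measurableSet_Ioi)
  have hbound : ∀ x ∈ halfSpace (n + 1), stretchEnergy s p b ψ x ^ (q / p) ≤ h (lastCoord x) := by
    intro x hx
    have hx0 : 0 < lastCoord x := hx
    rcases le_or_gt (lastCoord x) 4 with h4 | h4
    · have := ENNReal.rpow_le_rpow (hnear x hx h4) hqp.le
      rw [ENNReal.mul_rpow_of_nonneg _ _ hqp.le, ENNReal.ofReal_rpow_of_nonneg (by positivity)
        hqp.le, ← Real.rpow_mul hx0.le] at this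
      simp only [hh]
      rw [indicator_of_mem (mem_Iic.2 h4)]
      exact this.trans le_self_add
    · have := ENNReal.rpow_le_rpow (hfar x h4.le) hqp.le
      rw [ENNReal.mul_rpow_of_nonneg _ _ hqp.le, ENNReal.ofReal_rpow_of_nonneg (by positivity)
        hqp.le, ← Real.rpow_mul hx0.le] at this
      simp only [hh]
      rw [indicator_of_mem (mem_Ioi.2 h4)]
      exact this.trans le_add_self
  have hfin : ∫⁻ t in Ioi (0 : ℝ), h t * ENNReal.ofReal (t ^ (-1 : ℝ)) < ∞ := by
    have h1 := lintegral_Ioo_rpow_lt_top (R := 5) (b := σ * (q / p) + -1)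
      (by linarith [mul_pos hσ hqp])
    have h2 := lintegral_Ioi_rpow_lt_top (R := 4) (b := -(1 + b) * (q / p) + -1)
      (by linarith [mul_pos (show 0 < 1 + b by linarith) hqp]) (by norm_num)
    have hle : ∫⁻ t in Ioi (0 : ℝ), h t * ENNReal.ofReal (t ^ (-1 : ℝ))
        ≤ C₁ ^ (q / p) * (∫⁻ t in Ioo (0 : ℝ) 5, ENNReal.ofReal (t ^ (σ * (q / p) + -1)))
          + C₂ ^ (q / p) * ∫⁻ t in Ioi (4 : ℝ), ENNReal.ofReal (t ^ (-(1 + b) * (q / p) + -1)) := by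
      rw [← lintegral_const_mul _ (by fun_prop), ← lintegral_const_mul _ (by fun_prop),
        ← lintegral_indicator measurableSet_Ioo, ← lintegral_indicator measurableSet_Ioi,
        ← lintegral_indicator measurableSet_Ioi,
        ← lintegral_add_left (Measurable.indicator (by fun_prop) measurableSet_Ioo)]
      refine lintegral_mono fun t => ?_
      by_cases ht : t ∈ Ioi (0 : ℝ)
      swap
      · rw [indicator_of_notMem ht]; exact zero_le
      have ht0 : 0 < t := ht
      rw [indicator_of_mem ht]
      simp only [hh, add_mul]
      gcongr
      · by_cases h4 : t ∈ Iic (4 : ℝ)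
        · have h4' : t ≤ 4 := h4
          rw [indicator_of_mem h4,
            indicator_of_mem (show t ∈ Ioo (0 : ℝ) 5 from ⟨ht0, by linarith⟩),
            Real.rpow_add ht0, ENNReal.ofReal_mul (by positivity), mul_assoc]
        · rw [indicator_of_notMem h4, zero_mul]; exact zero_le
      · by_cases h4 : t ∈ Ioi (4 : ℝ)
        · rw [indicator_of_mem h4, indicator_of_mem h4, Real.rpow_add ht0,
            ENNReal.ofReal_mul (by positivity), mul_assoc]
        · rw [indicator_of_notMem h4, zero_mul]; exact zero_le
    refine hle.trans_lt (ENNReal.add_lt_top.2 ⟨ENNReal.mul_lt_top ?_ h1, ENNReal.mul_lt_top ?_ h2⟩)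
    · exact ENNReal.rpow_lt_top_of_nonneg hqp.le hC₁
    · exact ENNReal.rpow_lt_top_of_nonneg hqp.le hC₂
  refine ⟨volume (Metric.ball (0 : EuclideanSpace ℝ (Fin n)) R)
    * ∫⁻ t in Ioi (0 : ℝ), h t * ENNReal.ofReal (t ^ (-1 : ℝ)),
    (ENNReal.mul_lt_top measure_ball_lt_top hfin).ne, fun k hk => ?_⟩
  calc _ ≤ ∫⁻ x in Metric.ball 0 R ∩ halfSpace (n + 1),
        h (k * lastCoord x) * ENNReal.ofReal (lastCoord x ^ (-1 : ℝ)) := by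
        refine setLIntegral_mono' (measurableSet_ball.inter measurableSet_halfSpace) fun x hx => ?_
        -- Stretchings commute with dilations, so the scale k only moves the point. It then
        -- disappears from the bound because dt/t is dilation invariant.
        have e : stretchEnergy s p b (fun y => g (k * lastCoord y)) x
            = stretchEnergy s p b ψ (k • x) := stretchEnergy_comp_smul s p b k ψ x
        have hkx : k • x ∈ halfSpace (n + 1) := mul_pos hk hx.2
        rw [e]
        gcongr
        exact hbound _ hkx
    _ ≤ volume (Metric.ball (0 : EuclideanSpace ℝ (Fin n)) R)
        * ∫⁻ t in Ioo (0 : ℝ) R, h (k * t) * ENNReal.ofReal (t ^ (-1 : ℝ)) :=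
        lintegral_ball_inter_halfSpace_le R (by fun_prop)
    _ ≤ _ := by
        rw [← lintegral_Ioi_comp_mul_inv hk]
        gcongr
        exact Ioo_subset_Ioi_self

theorem lintegral_rpow_mul_one_add_rpow_lt_top {b c : ℝ} (hb : -1 < b) (hbc : b + c < -1) :
    ∫⁻ t in Ioi (0 : ℝ), ENNReal.ofReal (t ^ b * (1 + t) ^ c) < ∞ := by
  have hsub : Ioi (0 : ℝ) ⊆ Ioo 0 2 ∪ Ioi 1 := by
    intro t ht
    rcases lt_or_ge t 2 with h | h
    · exact Or.inl ⟨ht, h⟩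
    · exact Or.inr (mem_Ioi.2 (by linarith))
  refine (lintegral_mono_set hsub).trans_lt ((lintegral_union_le _ _ _).trans_lt
    (ENNReal.add_lt_top.2 ⟨?_, ?_⟩))
  · refine setLIntegral_lt_top_of_le_const_mul measurableSet_Ioo (C := 3 ^ |c|)
      (g := fun t => t ^ b) (by positivity) (fun t ht => ?_) (lintegral_Ioo_rpow_lt_top hb)
    have h0 : 0 < t := ht.1
    have := rpow_le_mul_rpow_of_comparable (x := 1) (y := 1 + t) (K := 3) (c := c) one_pos
      (by norm_num) (by linarith) (by linarith [ht.2])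
    rw [Real.one_rpow, mul_one] at this
    rw [mul_comm]
    gcongr
  · refine setLIntegral_lt_top_of_le_const_mul measurableSet_Ioi (C := 2 ^ |c|)
      (g := fun t => t ^ (b + c)) (by positivity) (fun t ht => ?_)
      (lintegral_Ioi_rpow_lt_top hbc one_pos)
    have ht' : 1 < t := ht
    have h0 : 0 < t := by linarith
    have := rpow_le_mul_rpow_of_comparable (x := t) (y := 1 + t) (K := 2) (c := c) h0
      (by norm_num) (by linarith) (by linarith)
    rw [Real.rpow_add h0, mul_left_comm]
    gcongr

/-- Outside the ball of radius 2 only y in the unit ball contribute, and there |x - y| is comparable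
to |x|. -/
theorem lintegral_inner_le_of_two_le_norm {n : ℕ} {s p b L : ℝ} (hp : 0 < p) (hb1 : -1 < b)
    (hL : 0 ≤ L) {χ : EuclideanSpace ℝ (Fin (n + 1)) → ℝ}
    (hχ1 : ∀ x y, |χ x - χ y| ≤ L) (hχ0 : ∀ x, 1 ≤ ‖x‖ → χ x = 0) :
    ∃ C : ℝ≥0∞, C ≠ ∞ ∧ ∀ x : EuclideanSpace ℝ (Fin (n + 1)), 2 ≤ ‖x‖ →
      ∫⁻ y in halfSpace (n + 1), ENNReal.ofReal (|χ x - χ y| ^ p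
        / ‖x - y‖ ^ (((n + 1 : ℕ) : ℝ) + s * p) * lastCoord y ^ b)
      ≤ C * ENNReal.ofReal (‖x‖ ^ (-(((n + 1 : ℕ) : ℝ) + s * p))) := by
  set D : ℝ := ((n + 1 : ℕ) : ℝ) + s * p with hD
  have hI := (lintegral_ball_inter_halfSpace_le (n := n) 1 (Φ := fun t => ENNReal.ofReal (t ^ b))
    (by fun_prop)).trans_lt (ENNReal.mul_lt_top measure_ball_lt_top (lintegral_Ioo_rpow_lt_top hb1))
  refine ⟨ENNReal.ofReal (L ^ p * 2 ^ |-D|)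
    * ∫⁻ x in Metric.ball 0 1 ∩ halfSpace (n + 1), ENNReal.ofReal (lastCoord x ^ b),
    (ENNReal.mul_lt_top ENNReal.ofReal_lt_top hI).ne, fun x hx => ?_⟩
  have hx0 : 0 < ‖x‖ := by linarith
  rw [mul_right_comm, ← ENNReal.ofReal_mul (by positivity),
    ← setLIntegral_indicator measurableSet_ball, ← lintegral_const_mul' _ _ ENNReal.ofReal_ne_top]
  refine setLIntegral_mono' measurableSet_halfSpace fun y hy => ?_
  have hy0 : 0 < lastCoord y := hy
  by_cases hy1 : y ∈ Metric.ball 0 1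
  · have hy1' : ‖y‖ < 1 := mem_ball_zero_iff.1 hy1
    rw [indicator_of_mem hy1, ← ENNReal.ofReal_mul (by positivity), div_eq_mul_inv,
      ← Real.rpow_neg (norm_nonneg _)]
    have h1 := norm_sub_norm_le x y
    have h2 := norm_sub_le x y
    have h3 := rpow_le_mul_rpow_of_comparable (x := ‖x‖) (y := ‖x - y‖) (K := 2) (c := -D) hx0
      one_le_two (by linarith) (by linarith)
    have h4 := Real.rpow_le_rpow (abs_nonneg _) (hχ1 x y) hp.le
    refine ENNReal.ofReal_le_ofReal ?_
    calc _ ≤ L ^ p * (2 ^ |-D| * ‖x‖ ^ (-D)) * lastCoord y ^ b := by gcongr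
      _ = _ := by ring
  · rw [hχ0 x (by linarith), hχ0 y (by simpa using hy1), sub_self, abs_zero,
      Real.zero_rpow hp.ne', zero_div, zero_mul, ENNReal.ofReal_zero]
    exact zero_le

/-- A compactly supported Lipschitz function has finite seminorm at the critical exponents. -/
theorem tlSeminorm_ne_top_of_lipschitz {n : ℕ} {s p q α b L : ℝ} (hs0 : 0 < s) (hs1 : s < 1)
    (hp : 1 ≤ p) (hq : 0 < q) (hb1 : -1 < b) (hb : b < s * p)
    (hbα : (s * p - b) * (q / p) = 1 + α) (hα1 : -1 < α)
    (hα : α < s * q - (1 - q / p) * ((n + 1 : ℕ) : ℝ)) (hL : 0 ≤ L)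
    {χ : EuclideanSpace ℝ (Fin (n + 1)) → ℝ} (hχ : Measurable χ) (hχ1 : ∀ x y, |χ x - χ y| ≤ L)
    (hχ2 : ∀ x y, |χ x - χ y| ≤ L * ‖x - y‖) (hχ0 : ∀ x, 1 ≤ ‖x‖ → χ x = 0) :
    tlSeminorm s p q α b χ ≠ ∞ := by
  have hp0 : 0 < p := by linarith
  have hqp : 0 < q / p := by positivity
  have hl := measurable_lastCoord (d := n + 1)
  obtain ⟨σ, hσ, C₁, hC₁, hnear⟩ := stretchEnergy_le_of_lastCoord_le (n := n) (R := 2) hs0 hs1 hp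
    hb1 hb hL (by norm_num) (ψ := χ) hχ1 hχ2
  obtain ⟨C₂, hC₂, hfar⟩ := lintegral_inner_le_of_two_le_norm (s := s) hp0 hb1 hL hχ1 hχ0
  set D : ℝ := ((n + 1 : ℕ) : ℝ) + s * p with hD
  unfold tlSeminorm
  rw [← lintegral_inter_add_sdiff _ (halfSpace (n + 1))
    (measurableSet_ball (x := (0 : EuclideanSpace ℝ (Fin (n + 1)))) (ε := 2))]
  refine (ENNReal.add_lt_top.2 ⟨?_, ?_⟩).ne
  · rw [inter_comm]
    have hm : MeasurableSet
        (Metric.ball (0 : EuclideanSpace ℝ (Fin (n + 1))) 2 ∩ halfSpace (n + 1)) :=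
      measurableSet_ball.inter measurableSet_halfSpace
    have hle : ∀ x ∈ Metric.ball (0 : EuclideanSpace ℝ (Fin (n + 1))) 2 ∩ halfSpace (n + 1),
        (∫⁻ y in halfSpace (n + 1), ENNReal.ofReal (|χ x - χ y| ^ p / ‖x - y‖ ^ D
          * lastCoord y ^ b)) ^ (q / p) * ENNReal.ofReal (lastCoord x ^ α)
        ≤ C₁ ^ (q / p) * ENNReal.ofReal (lastCoord x ^ (σ * (q / p) + -1)) := by
      rintro x ⟨hx2, hx⟩
      have hx0 : 0 < lastCoord x := hx
      have hxle : lastCoord x ≤ 2 := (le_abs_self _).trans ((abs_lastCoord_le x).trans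
        (mem_ball_zero_iff.1 hx2).le)
      rw [rpow_inner_mul_eq_stretchEnergy hp0 hq hbα hχ hx, Real.rpow_add hx0,
        ENNReal.ofReal_mul (by positivity), ← mul_assoc]
      gcongr
      refine (ENNReal.rpow_le_rpow (hnear x hx hxle) hqp.le).trans_eq ?_
      rw [ENNReal.mul_rpow_of_nonneg _ _ hqp.le, ENNReal.ofReal_rpow_of_nonneg (by positivity)
        hqp.le, ← Real.rpow_mul hx0.le]
    refine (setLIntegral_mono' hm hle).trans_lt ?_
    rw [lintegral_const_mul _ (by fun_prop)]
    refine ENNReal.mul_lt_top (ENNReal.rpow_lt_top_of_nonneg hqp.le hC₁) ?_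
    exact (lintegral_ball_inter_halfSpace_le 2
      (Φ := fun t => ENNReal.ofReal (t ^ (σ * (q / p) + -1))) (by fun_prop)).trans_lt
      (ENNReal.mul_lt_top measure_ball_lt_top
        (lintegral_Ioo_rpow_lt_top (by linarith [mul_pos hσ hqp])))
  · have hDM : D * (q / p) = ((n + 1 : ℕ) : ℝ) * (q / p) + s * q := by
      rw [hD]; field_simp
    set M : ℝ := D * (q / p) with hM
    -- The only place where the additional hypothesis of the sharpness statement enters: the decay
    -- |x|^{-M} must beat the growth of x_d^α dx in dimension n + 1.
    have hMn : α + (n + 1) < M := by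
      rw [hDM]; push_cast at hα ⊢; linarith
    have hm : MeasurableSet (halfSpace (n + 1)
        \ Metric.ball (0 : EuclideanSpace ℝ (Fin (n + 1))) 2) :=
      measurableSet_halfSpace.diff measurableSet_ball
    -- Replacing |x| by the comparable |x + e_d| puts the base point of the slicing formula outside
    -- the half-space, at height -1, so the vertical integral has no singularity.
    have hle : ∀ x ∈ halfSpace (n + 1) \ Metric.ball (0 : EuclideanSpace ℝ (Fin (n + 1))) 2,
        (∫⁻ y in halfSpace (n + 1), ENNReal.ofReal (|χ x - χ y| ^ p / ‖x - y‖ ^ D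
          * lastCoord y ^ b)) ^ (q / p) * ENNReal.ofReal (lastCoord x ^ α)
        ≤ C₂ ^ (q / p) * ENNReal.ofReal (2 ^ |-M|)
          * (ENNReal.ofReal (lastCoord x ^ α)
            * ENNReal.ofReal (‖-lastVec (n + 1) - x‖ ^ (-M))) := by
      rintro x ⟨hx, hx2⟩
      have hx0 : 0 < lastCoord x := hx
      have hx2' : 2 ≤ ‖x‖ := by simpa using hx2
      have he : ‖lastVec (n + 1)‖ = 1 := by simp [lastVec]
      have h1 : ‖-lastVec (n + 1) - x‖ = ‖x + lastVec (n + 1)‖ := by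
        rw [← norm_neg]; congr 1; abel
      have h2 := norm_add_le x (lastVec (n + 1))
      have h3 := norm_sub_le (x + lastVec (n + 1)) (lastVec (n + 1))
      rw [add_sub_cancel_right] at h3
      have h4 := rpow_le_mul_rpow_of_comparable (x := ‖-lastVec (n + 1) - x‖) (y := ‖x‖) (K := 2)
        (c := -M) (by rw [h1]; linarith) one_le_two (by rw [h1]; linarith) (by rw [h1]; linarith)
      have h5 := ENNReal.rpow_le_rpow (hfar x hx2') hqp.le
      rw [ENNReal.mul_rpow_of_nonneg _ _ hqp.le, ENNReal.ofReal_rpow_of_nonneg (by positivity)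
        hqp.le, ← Real.rpow_mul (norm_nonneg _), neg_mul, ← hM] at h5
      have h6 := h5.trans (mul_le_mul_right (ENNReal.ofReal_le_ofReal h4) _)
      rw [ENNReal.ofReal_mul (by positivity)] at h6
      refine (mul_le_mul_left h6 _).trans_eq ?_
      ring
    refine (setLIntegral_mono' hm hle).trans_lt ?_
    rw [lintegral_const_mul _ (by fun_prop)]
    refine ENNReal.mul_lt_top (ENNReal.mul_lt_top (ENNReal.rpow_lt_top_of_nonneg hqp.le hC₂)
      ENNReal.ofReal_lt_top) ((lintegral_mono_set sdiff_subset).trans_lt ?_)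
    rw [lintegral_halfSpace_mul_norm_rpow_neg (by linarith) _
      (Φ := fun t => ENNReal.ofReal (t ^ α)) (by fun_prop)]
    refine ENNReal.mul_lt_top ENNReal.ofReal_lt_top ?_
    have hcoord : lastCoord (-lastVec (n + 1)) = -1 := by
      have : lastCoord (-lastVec (n + 1)) = -lastCoord (lastVec (n + 1)) := rfl
      rw [this, lastCoord_lastVec]
    refine lt_of_eq_of_lt ?_ (lintegral_rpow_mul_one_add_rpow_lt_top (b := α) (c := n - M) hα1
      (by linarith))
    refine setLIntegral_congr_fun measurableSet_Ioi fun t ht => ?_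
    have ht0 : 0 < t := ht
    rw [hcoord, ← ENNReal.ofReal_mul (by positivity), show (-1 : ℝ) - t = -(1 + t) by ring, abs_neg,
      abs_of_pos (by linarith : 0 < 1 + t)]

end FiniteEnergy

/-! ### Sharpness of the constant -/

section Sharpness

variable {d : ℕ} [NeZero d]

/-- The kernel `y_d^β |x - y|^{-(d + sp)}` of the seminorm. -/
noncomputable def tlKernel (s p β : ℝ) (x y : EuclideanSpace ℝ (Fin d)) : ℝ≥0∞ :=
  ENNReal.ofReal (‖x - y‖ ^ (-((d : ℝ) + s * p)) * lastCoord y ^ β)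

theorem measurable_tlKernel (s p β : ℝ) :
    Measurable (Function.uncurry (tlKernel (d := d) s p β)) := by
  have hl : Measurable fun w : EuclideanSpace ℝ (Fin d) × EuclideanSpace ℝ (Fin d) =>
    lastCoord w.2 := measurable_lastCoord.comp measurable_snd
  unfold tlKernel
  simp only [Function.uncurry_def]
  fun_prop

theorem ofReal_rpow_mul_tlKernel {s p β D : ℝ} (hp : 0 ≤ p) (hD : 0 ≤ D)
    (x y : EuclideanSpace ℝ (Fin d)) :
    ENNReal.ofReal D ^ p * tlKernel s p β x y
      = ENNReal.ofReal (D ^ p / ‖x - y‖ ^ ((d : ℝ) + s * p) * lastCoord y ^ β) := by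
  rw [tlKernel, ENNReal.ofReal_rpow_of_nonneg hD hp, ← ENNReal.ofReal_mul (by positivity),
    div_eq_mul_inv, ← Real.rpow_neg (norm_nonneg _), mul_assoc]

theorem tlSeminorm_rpow_eq_mixedNorm {s p q α β : ℝ} (hp : 0 ≤ p)
    (u : EuclideanSpace ℝ (Fin d) → ℝ) :
    tlSeminorm s p q α β u ^ (1 / q)
      = mixedNorm (volume.restrict (halfSpace d)) (volume.restrict (halfSpace d)) p q
        (tlKernel s p β) (fun x => ENNReal.ofReal (lastCoord x ^ α))
        (fun x y => ENNReal.ofReal |u x - u y|) := by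
  simp only [tlSeminorm, mixedNorm, ofReal_rpow_mul_tlKernel hp (abs_nonneg _)]

/-- In stretched coordinates x_d^{-a} - y_d^{-a} factors as x_d^{-a}(1 - η_d^{-a}), so the profile
integral appears as an equality. -/
theorem lintegral_groundState_eq {n : ℕ} {s p a β : ℝ} (hs0 : 0 < s) (hp : 0 < p)
    {x : EuclideanSpace ℝ (Fin (n + 1))} (hx : x ∈ halfSpace (n + 1)) :
    ∫⁻ y in halfSpace (n + 1), ENNReal.ofReal (|lastCoord x ^ (-a) - lastCoord y ^ (-a)| ^ p
        / ‖x - y‖ ^ (((n + 1 : ℕ) : ℝ) + s * p) * lastCoord y ^ β)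
      = ENNReal.ofReal (lastCoord x ^ (β - s * p - a * p))
        * (ENNReal.ofReal (bracketConst n (((n + 1 : ℕ) : ℝ) + s * p))
          * profileIntegral s p a β) := by
  have hl := measurable_lastCoord (d := n + 1)
  have hx0 : 0 < lastCoord x := hx
  have hslice := lintegral_stretchKernel_eq (n := n) (s := s) (p := p) (β := β) (by positivity)
    (Φ := fun t => |1 - t ^ (-a)| ^ p) (by fun_prop) (fun t _ => by positivity)
  rw [lintegral_kernel_eq_stretch hx
    (W := fun y => |lastCoord x ^ (-a) - lastCoord y ^ (-a)| ^ p) (by fun_prop),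
    profileIntegral, ← hslice, sub_eq_add_neg (β - s * p), Real.rpow_add hx0,
    ENNReal.ofReal_mul (by positivity), mul_assoc]
  congr 1
  rw [← lintegral_const_mul' _ _ ENNReal.ofReal_ne_top]
  refine setLIntegral_congr_fun measurableSet_halfSpace fun η hη => ?_
  have hη0 : 0 < lastCoord η := hη
  rw [← ENNReal.ofReal_mul (by positivity), lastCoord_stretch, Real.mul_rpow hx0.le hη0.le,
    ← mul_assoc, ← mul_one_sub, abs_mul, abs_of_pos (by positivity),
    Real.mul_rpow (by positivity) (abs_nonneg _), ← Real.rpow_mul hx0.le, neg_mul]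

/-- Comparison of the seminorm of `x_d^{-a} φ` with the Hardy integral, where `x_d^{-a}` is the
ground state. -/
theorem tlSeminorm_groundState_mul_le {n : ℕ} {s p q α β a : ℝ} (hs0 : 0 < s)
    (hq : 1 ≤ q) (hpq : q ≤ p) (ha : a = (1 + α + q * β / p - s * q) / q)
    {φ : EuclideanSpace ℝ (Fin (n + 1)) → ℝ} (hφ : Measurable φ) :
    tlSeminorm s p q α β (fun x => lastCoord x ^ (-a) * φ x) ^ (1 / q)
      ≤ hardyConst (n + 1) s p q α β ^ (1 / q)
          * (∫⁻ x in halfSpace (n + 1),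
            ENNReal.ofReal (|φ x| ^ q * lastCoord x ^ (-1 : ℝ))) ^ (1 / q)
        + tlSeminorm s p q α (β - a * p) φ ^ (1 / q) := by
  have hq0 : 0 < q := by linarith
  have hp0 : 0 < p := by linarith
  have hqp : 0 < q / p := by positivity
  have hl := measurable_lastCoord (d := n + 1)
  have hl1 : Measurable fun w : EuclideanSpace ℝ (Fin (n + 1)) × EuclideanSpace ℝ (Fin (n + 1)) =>
    lastCoord w.1 := hl.comp measurable_fst
  have hl2 : Measurable fun w : EuclideanSpace ℝ (Fin (n + 1)) × EuclideanSpace ℝ (Fin (n + 1)) =>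
    lastCoord w.2 := hl.comp measurable_snd
  have hφ1 : Measurable fun w : EuclideanSpace ℝ (Fin (n + 1)) × EuclideanSpace ℝ (Fin (n + 1)) =>
    φ w.1 := hφ.comp measurable_fst
  have hφ2 : Measurable fun w : EuclideanSpace ℝ (Fin (n + 1)) × EuclideanSpace ℝ (Fin (n + 1)) =>
    φ w.2 := hφ.comp measurable_snd
  set V : EuclideanSpace ℝ (Fin (n + 1)) → EuclideanSpace ℝ (Fin (n + 1)) → ℝ≥0∞ :=
    fun x y => ENNReal.ofReal (|φ x| * |lastCoord x ^ (-a) - lastCoord y ^ (-a)|) with hV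
  set W : EuclideanSpace ℝ (Fin (n + 1)) → EuclideanSpace ℝ (Fin (n + 1)) → ℝ≥0∞ :=
    fun x y => ENNReal.ofReal (lastCoord y ^ (-a) * |φ x - φ y|) with hW
  rw [tlSeminorm_rpow_eq_mixedNorm hp0.le]
  refine (mixedNorm_le_add (V := V) (W := W) (by linarith) hq (measurable_tlKernel s p β)
    (by fun_prop) (by simp only [hV, Function.uncurry_def]; fun_prop)
    (by simp only [hW, Function.uncurry_def]; fun_prop) ?_).trans (add_le_add (le_of_eq ?_)
      (le_of_eq ?_))
  · refine (ae_restrict_mem measurableSet_halfSpace).mono fun x hx =>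
      (ae_restrict_mem measurableSet_halfSpace).mono fun y hy => ?_
    have hy0 : 0 < lastCoord y := hy
    rw [hV, hW, ← ENNReal.ofReal_add (by positivity) (by positivity)]
    refine ENNReal.ofReal_le_ofReal ?_
    -- The ground state in the second term is evaluated at y, so that its p-th power merges with
    -- y_d^β and shifts the weight to β - ap.
    have e : lastCoord x ^ (-a) * φ x - lastCoord y ^ (-a) * φ y
        = φ x * (lastCoord x ^ (-a) - lastCoord y ^ (-a)) + lastCoord y ^ (-a) * (φ x - φ y) := by
      ring
    rw [e]
    refine (abs_add_le _ _).trans_eq ?_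
    rw [abs_mul, abs_mul, abs_of_pos (Real.rpow_pos_of_pos hy0 _)]
  · rw [← ENNReal.mul_rpow_of_nonneg _ _ (by positivity), mixedNorm]
    congr 1
    rw [← lintegral_const_mul _ (by fun_prop)]
    refine setLIntegral_congr_fun measurableSet_halfSpace fun x hx => ?_
    have hx0 : 0 < lastCoord x := hx
    have e1 : ∫⁻ y in halfSpace (n + 1), V x y ^ p * tlKernel s p β x y
        = ENNReal.ofReal (|φ x|) ^ p * ∫⁻ y in halfSpace (n + 1),
          ENNReal.ofReal (|lastCoord x ^ (-a) - lastCoord y ^ (-a)| ^ p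
            / ‖x - y‖ ^ (((n + 1 : ℕ) : ℝ) + s * p) * lastCoord y ^ β) := by
      rw [← lintegral_const_mul' _ _ (ENNReal.rpow_ne_top_of_nonneg hp0.le ENNReal.ofReal_ne_top)]
      refine lintegral_congr fun y => ?_
      rw [← ofReal_rpow_mul_tlKernel hp0.le (abs_nonneg _), ← mul_assoc,
        ← ENNReal.mul_rpow_of_nonneg _ _ hp0.le, ← ENNReal.ofReal_mul (abs_nonneg _)]
    rw [e1, lintegral_groundState_eq hs0 hp0 hx, hardyConst_eq n hq0.ne' hp0.ne', ← ha,
      ENNReal.mul_rpow_of_nonneg _ _ hqp.le, ENNReal.mul_rpow_of_nonneg _ _ hqp.le,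
      ← ENNReal.rpow_mul, mul_div_cancel₀ _ hp0.ne', ENNReal.ofReal_rpow_of_nonneg (by positivity)
      hqp.le, ENNReal.ofReal_rpow_of_nonneg (by positivity) hq0.le, ← Real.rpow_mul hx0.le,
      show (-1 : ℝ) = (β - s * p - a * p) * (q / p) + α by rw [ha]; field_simp; ring,
      Real.rpow_add hx0, ENNReal.ofReal_mul (by positivity), ENNReal.ofReal_mul (by positivity)]
    ring
  · rw [tlSeminorm_rpow_eq_mixedNorm hp0.le, mixedNorm, mixedNorm]
    congr 1
    refine lintegral_congr fun x => ?_
    congr 2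
    refine setLIntegral_congr_fun measurableSet_halfSpace fun y hy => ?_
    have hy0 : 0 < lastCoord y := hy
    rw [ofReal_rpow_mul_tlKernel hp0.le (abs_nonneg _), hW,
      ofReal_rpow_mul_tlKernel hp0.le (by positivity)]
    congr 1
    rw [Real.mul_rpow (by positivity) (abs_nonneg _), ← Real.rpow_mul hy0.le, sub_eq_add_neg β,
      Real.rpow_add hy0, neg_mul]
    ring

/-- Separates the two cut-offs. With χ evaluated at x in the second term, the energy of g, which has
no compact support, is only integrated over a half-ball. -/
theorem tlSeminorm_mul_le {s p q α b : ℝ} (hp : 1 ≤ p) (hq : 1 ≤ q)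
    (hbα : (s * p - b) * (q / p) = 1 + α) {χ g : EuclideanSpace ℝ (Fin d) → ℝ}
    (hχ : Measurable χ) (hg : Measurable g) (hχ1 : ∀ x, |χ x| ≤ 1) (hg1 : ∀ x, |g x| ≤ 1)
    {R : ℝ} (hχ0 : ∀ x, R ≤ ‖x‖ → χ x = 0) :
    tlSeminorm s p q α b (fun x => χ x * g x) ^ (1 / q)
      ≤ tlSeminorm s p q α b χ ^ (1 / q)
        + (∫⁻ x in Metric.ball 0 R ∩ halfSpace d, stretchEnergy s p b g x ^ (q / p)
          * ENNReal.ofReal (lastCoord x ^ (-1 : ℝ))) ^ (1 / q) := by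
  have hq0 : 0 < q := by linarith
  have hp0 : 0 < p := by linarith
  have hqp : 0 < q / p := by positivity
  have hl := measurable_lastCoord (d := d)
  have hχ' : Measurable fun w : EuclideanSpace ℝ (Fin d) × EuclideanSpace ℝ (Fin d) => χ w.1 :=
    hχ.comp measurable_fst
  have hχ'' : Measurable fun w : EuclideanSpace ℝ (Fin d) × EuclideanSpace ℝ (Fin d) => χ w.2 :=
    hχ.comp measurable_snd
  have hg' : Measurable fun w : EuclideanSpace ℝ (Fin d) × EuclideanSpace ℝ (Fin d) => g w.1 :=
    hg.comp measurable_fst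
  have hg'' : Measurable fun w : EuclideanSpace ℝ (Fin d) × EuclideanSpace ℝ (Fin d) => g w.2 :=
    hg.comp measurable_snd
  rw [tlSeminorm_rpow_eq_mixedNorm hp0.le, tlSeminorm_rpow_eq_mixedNorm hp0.le]
  refine (mixedNorm_le_add (V := fun x y => ENNReal.ofReal |χ x - χ y|)
    (W := fun x y => ENNReal.ofReal (|χ x| * |g x - g y|)) hp hq (measurable_tlKernel s p b)
    (by fun_prop) (by simp only [Function.uncurry_def]; fun_prop)
    (by simp only [Function.uncurry_def]; fun_prop) ?_).trans (add_le_add le_rfl ?_)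
  · refine Filter.Eventually.of_forall fun x => Filter.Eventually.of_forall fun y => ?_
    rw [← ENNReal.ofReal_add (by positivity) (by positivity)]
    refine ENNReal.ofReal_le_ofReal ?_
    have e : χ x * g x - χ y * g y = (χ x - χ y) * g y + χ x * (g x - g y) := by ring
    rw [e]
    refine (abs_add_le _ _).trans ?_
    rw [abs_mul, abs_mul]
    gcongr
    exact mul_le_of_le_one_right (abs_nonneg _) (hg1 y)
  · rw [mixedNorm, ← setLIntegral_indicator measurableSet_ball]
    refine ENNReal.rpow_le_rpow (setLIntegral_mono' measurableSet_halfSpace fun x hx => ?_)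
      (by positivity)
    by_cases hxR : x ∈ Metric.ball 0 R
    · rw [indicator_of_mem hxR, ← rpow_inner_mul_eq_stretchEnergy hp0 hq0 hbα hg hx]
      gcongr with y
      rw [← ofReal_rpow_mul_tlKernel hp0.le (abs_nonneg _)]
      gcongr
      exact mul_le_of_le_one_left (abs_nonneg _) (hχ1 x)
    · rw [hχ0 x (by simpa using hxR)]
      simp [hp0, hqp]

theorem exists_lipschitz_cutoff (V : Type*) [NormedAddCommGroup V] [InnerProductSpace ℝ V]
    [FiniteDimensional ℝ V] {r R : ℝ} (hr : 0 < r) (hrR : r < R) :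
    ∃ χ : V → ℝ, ContDiff ℝ 1 χ ∧ (∀ x, 0 ≤ χ x) ∧ (∀ x, χ x ≤ 1) ∧ (∀ x, R ≤ ‖x‖ → χ x = 0) ∧
      (∀ x, ‖x‖ ≤ r → χ x = 1) ∧
      ∃ L : ℝ, 1 ≤ L ∧ ∀ x y, |χ x - χ y| ≤ L ∧ |χ x - χ y| ≤ L * ‖x - y‖ := by
  let f : ContDiffBump (0 : V) := ⟨r, R, hr, hrR⟩
  have hf1 : ContDiff ℝ 1 f := f.contDiff
  obtain ⟨L, hL⟩ := hf1.lipschitzWith_of_hasCompactSupport f.hasCompactSupport one_ne_zero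
  refine ⟨f, hf1, fun x => f.nonneg, fun x => f.le_one, fun x hx => ?_, fun x hx => ?_,
    max 1 L, le_max_left _ _, fun x y => ⟨?_, ?_⟩⟩
  · exact f.zero_of_le_dist (by simpa using hx)
  · exact f.one_of_mem_closedBall (by simpa using hx)
  · refine le_trans ?_ (le_max_left _ _)
    rw [abs_le]
    constructor <;> linarith [f.nonneg (x := x), f.nonneg (x := y), f.le_one (x := x),
      f.le_one (x := y)]
  · have := hL.norm_sub_le x y
    rw [Real.norm_eq_abs] at this
    refine this.trans ?_
    gcongr
    exact le_max_right _ _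

theorem lintegral_Ioo_inv_eq_top {R : ℝ} (hR : 0 < R) :
    ∫⁻ t in Ioo (0 : ℝ) R, ENNReal.ofReal (t ^ (-1 : ℝ)) = ∞ := by
  by_contra h
  have hinv : IntegrableOn (fun t : ℝ => t⁻¹) (Ioo 0 R) := by
    refine ⟨by fun_prop, ?_⟩
    rw [hasFiniteIntegral_iff_enorm]
    refine lt_of_eq_of_lt ?_ (lt_top_iff_ne_top.2 h)
    refine setLIntegral_congr_fun measurableSet_Ioo fun t ht => ?_
    have ht0 : 0 < t := ht.1
    rw [Real.enorm_of_nonneg (by positivity), Real.rpow_neg_one]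
  rw [← intervalIntegrable_iff_integrableOn_Ioo_of_le hR.le, intervalIntegrable_inv_iff] at hinv
  rcases hinv with h | h
  · exact hR.ne h
  · exact h left_mem_uIcc

/-- The half-ball where χ = 1 contains a cylinder of radius and height r/2, over which ∫ dt/t
diverges. -/
theorem lintegral_halfSpace_inv_eq_top {n : ℕ} {q r : ℝ} (hr : 0 < r)
    {χ : EuclideanSpace ℝ (Fin (n + 1)) → ℝ} (hχm : Measurable χ) (hχ : ∀ x, ‖x‖ ≤ r → χ x = 1) :
    ∫⁻ x in halfSpace (n + 1), ENNReal.ofReal (|χ x| ^ q * lastCoord x ^ (-1 : ℝ)) = ∞ := by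
  have hl := measurable_lastCoord (d := n + 1)
  rw [lintegral_halfSpace_eq (by fun_prop), ← top_le_iff]
  have hB : volume (Metric.ball (0 : EuclideanSpace ℝ (Fin n)) (r / 2)) ≠ 0 :=
    (Metric.measure_ball_pos volume _ (by positivity)).ne'
  calc ∞ = ∫⁻ t in Ioo (0 : ℝ) (r / 2), ENNReal.ofReal (t ^ (-1 : ℝ))
        * volume (Metric.ball (0 : EuclideanSpace ℝ (Fin n)) (r / 2)) := by
        rw [lintegral_mul_const _ (by fun_prop), lintegral_Ioo_inv_eq_top (by positivity),
          ENNReal.top_mul hB]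
    _ ≤ ∫⁻ t in Ioo (0 : ℝ) (r / 2), ∫⁻ z : EuclideanSpace ℝ (Fin n), ENNReal.ofReal
        (|χ (joinLast t z)| ^ q * lastCoord (joinLast t z) ^ (-1 : ℝ)) := by
        refine setLIntegral_mono' measurableSet_Ioo fun t ht => ?_
        have ht0 : 0 < t := ht.1
        rw [← lintegral_indicator_const measurableSet_ball]
        refine lintegral_mono fun z => ?_
        by_cases hz : z ∈ Metric.ball (0 : EuclideanSpace ℝ (Fin n)) (r / 2)
        · have hz' : ‖z‖ < r / 2 := mem_ball_zero_iff.1 hz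
          have hnorm : ‖joinLast t z‖ ≤ r := by
            refine le_of_sq_le_sq ?_ hr.le
            rw [norm_sq_joinLast]
            nlinarith [norm_nonneg z, ht.2]
          rw [indicator_of_mem hz, hχ _ hnorm, lastCoord_joinLast, abs_one, Real.one_rpow, one_mul]
        · rw [indicator_of_notMem hz]; exact zero_le
    _ ≤ _ := lintegral_mono_set Ioo_subset_Ioi_self

/-- The function vanishes for |x_d| < 1/k, so the singularity of the ground state at the boundary is
never met and the same test functions serve both choices of Ω. -/
theorem isCcOne_groundState_mul {Ω : Set (EuclideanSpace ℝ (Fin d))} (hHΩ : halfSpace d ⊆ Ω)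
    (hΩ : ∀ x ∈ Ω, 0 ≤ lastCoord x) (a : ℝ) {k : ℝ} (hk : 0 < k)
    {χ : EuclideanSpace ℝ (Fin d) → ℝ} {ρ : ℝ → ℝ} (hχ : ContDiff ℝ 1 χ) (hρ : ContDiff ℝ 1 ρ)
    (hχ0 : ∀ x, 1 ≤ ‖x‖ → χ x = 0) (hρ1 : ∀ t, ‖t‖ ≤ 1 → ρ t = 1) :
    IsCcOne Ω fun x => lastCoord x ^ (-a) * (χ x * (1 - ρ (k * lastCoord x))) := by
  have hlc : ContDiff ℝ 1 (lastCoord : EuclideanSpace ℝ (Fin d) → ℝ) := by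
    unfold lastCoord; fun_prop
  have hzero : ∀ x : EuclideanSpace ℝ (Fin d), |lastCoord x| < 1 / k →
      lastCoord x ^ (-a) * (χ x * (1 - ρ (k * lastCoord x))) = 0 := by
    intro x hx
    rw [hρ1 _ (by
      rw [norm_mul, Real.norm_eq_abs, Real.norm_eq_abs, abs_of_pos hk, mul_comm]
      exact ((lt_div_iff₀ hk).1 hx).le)]
    simp
  refine ⟨fun x hx => ContDiffAt.contDiffWithinAt ?_,
    Metric.closedBall 0 1 ∩ {x | 1 / k ≤ lastCoord x},
    (isCompact_closedBall 0 1).inter_right (isClosed_le continuous_const continuous_lastCoord),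
    fun x hx => hHΩ (lt_of_lt_of_le (one_div_pos.2 hk) hx.2), fun x hx => ?_⟩
  · rcases lt_or_ge |lastCoord x| (1 / k) with h | h
    · have hopen : IsOpen {x : EuclideanSpace ℝ (Fin d) | |lastCoord x| < 1 / k} :=
        isOpen_lt continuous_lastCoord.abs continuous_const
      refine (contDiffAt_const (c := (0 : ℝ))).congr_of_eventuallyEq ?_
      filter_upwards [hopen.mem_nhds h] with y hy using hzero y hy
    · have hne : lastCoord x ≠ 0 := by
        intro h0
        rw [h0, abs_zero] at h
        exact absurd h (not_le.2 (by positivity))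
      refine (hlc.contDiffAt.rpow_const_of_ne hne).mul (hχ.contDiffAt.mul ?_)
      exact (contDiff_const.sub (hρ.comp (contDiff_const.mul hlc))).contDiffAt
  · by_cases h1 : 1 ≤ ‖x‖
    · simp [hχ0 x h1]
    · refine hzero x ?_
      rw [abs_of_nonneg (hΩ x hx.1)]
      by_contra h2
      exact hx.2 ⟨by simpa using (not_le.1 h1).le, not_lt.1 h2⟩

theorem le_of_forall_mul_le_mul_add {ι : Type*} {c δ M : ℝ≥0∞} {t : ι → ℝ≥0∞} (hM : M ≠ ∞)
    (ht : ∀ i, t i ≠ ∞) (h : ∀ i, c * t i ≤ δ * t i + M) (hsup : ⨆ i, t i = ∞) : c ≤ δ := by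
  by_contra hc
  obtain ⟨c', hδc', hc'⟩ := exists_between (not_le.1 hc)
  have hδ : δ ≠ ∞ := (hδc'.trans_le le_top).ne
  have hpos : c' - δ ≠ 0 := (tsub_pos_iff_lt.2 hδc').ne'
  have hb : ∀ i, t i ≤ M / (c' - δ) := by
    intro i
    rw [ENNReal.le_div_iff_mul_le (Or.inl hpos) (Or.inr hM), mul_comm,
      ENNReal.sub_mul (fun _ _ => ht i), tsub_le_iff_left]
    exact (mul_le_mul_left hc'.le _).trans (h i)
  have : (∞ : ℝ≥0∞) ≤ M / (c' - δ) := hsup ▸ iSup_le hb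
  exact (ENNReal.div_lt_top hM hpos).ne (top_le_iff.1 this)

/-- Tests the inequality on truncated ground states: after q-th roots both sides are linear in the
diverging Hardy norm, up to an error independent of the truncation, so the coefficients compare. -/
theorem le_hardyConst_of_forall {n : ℕ} {s p q α β : ℝ} (hs0 : 0 < s) (hs1 : s < 1)
    (hq : 1 ≤ q) (hpq : q ≤ p) (hα : α < s * q - (1 - q / p)) (hα1 : -1 < α)
    (hαd : α < s * q - (1 - q / p) * ((n + 1 : ℕ) : ℝ))
    {Ω : Set (EuclideanSpace ℝ (Fin (n + 1)))}
    (hΩ : (s * q - α - q * β / p < 1 ∧ Ω = closure (halfSpace (n + 1))) ∨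
      (1 < s * q - α - q * β / p ∧ Ω = halfSpace (n + 1))) {C : ℝ≥0∞}
    (hC : ∀ u : EuclideanSpace ℝ (Fin (n + 1)) → ℝ, IsCcOne Ω u →
      C * hardyIntegral s p q α β u ≤ tlSeminorm s p q α β u) :
    C ≤ hardyConst (n + 1) s p q α β := by
  have hq0 : 0 < q := by linarith
  have hp0 : 0 < p := by linarith
  have hp1 : 1 ≤ p := hq.trans hpq
  have hl := measurable_lastCoord (d := n + 1)
  set a := (1 + α + q * β / p - s * q) / q with ha
  set b := β - a * p with hb
  have hbα : (s * p - b) * (q / p) = 1 + α := by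
    rw [hb, ha]; field_simp; ring
  have hqp : 0 < q / p := by positivity
  -- By the critical relation, b < sp is equivalent to α > -1, and b > -1 to α < sq - (1 - q/p).
  have hbsp : b < s * p := by
    by_contra h
    nlinarith
  have hb1 : -1 < b := by
    have h1 : (s * p - b) * (q / p) = s * q - b * (q / p) := by field_simp
    have h2 : 0 < (1 + b) * (q / p) := by linarith
    nlinarith [(pos_iff_pos_of_mul_pos h2).2 hqp]
  obtain ⟨χ, hχs, hχ0, hχ1, hχout, hχin, L, hL1, hL⟩ := exists_lipschitz_cutoff
    (EuclideanSpace ℝ (Fin (n + 1))) (r := 1 / 2) (R := 1) (by norm_num) (by norm_num)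
  obtain ⟨ρ, hρs, hρ0, hρ1, hρout, hρin, L', hL1', hL'⟩ := exists_lipschitz_cutoff ℝ
    (r := 1) (R := 2) (by norm_num) (by norm_num)
  have hχm : Measurable χ := hχs.continuous.measurable
  have hρm : Measurable ρ := hρs.continuous.measurable
  have hρsub : ∀ t t', (1 - ρ t) - (1 - ρ t') = -(ρ t - ρ t') := fun t t' => by ring
  obtain ⟨M, hM, hvert⟩ := exists_lintegral_stretchEnergy_vertical_le (n := n) (s := s) (p := p)
    (q := q) (b := b) (L := L') hs0 hs1 hp1 hq0 hb1 hbsp (by linarith) (g := fun t => 1 - ρ t)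
    (by fun_prop) (fun t t' => by rw [hρsub, abs_neg]; exact (hL' t t').1)
    (fun t t' => by rw [hρsub, abs_neg]; exact (hL' t t').2)
    (fun t ht => by
      rw [hρout t (by rw [Real.norm_eq_abs]; exact ht.trans (le_abs_self t)), sub_zero]) 1
  have hTχ := tlSeminorm_ne_top_of_lipschitz (n := n) hs0 hs1 hp1 hq0 hb1 hbsp hbα hα1 hαd
    (by linarith : 0 ≤ L) hχm (fun x y => (hL x y).1) (fun x y => (hL x y).2) hχout
  -- The scale is k + 1 rather than k so that it is positive for every index.
  set φ : ℕ → EuclideanSpace ℝ (Fin (n + 1)) → ℝ :=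
    fun k x => χ x * (1 - ρ (((k : ℝ) + 1) * lastCoord x)) with hφ
  have hφm : ∀ k, Measurable (φ k) := fun k => by
    simp only [hφ]; fun_prop
  set P : ℕ → ℝ≥0∞ := fun k => ∫⁻ x in halfSpace (n + 1),
    ENNReal.ofReal (|φ k x| ^ q * lastCoord x ^ (-1 : ℝ)) with hP
  have hΩ0 : ∀ x ∈ Ω, 0 ≤ lastCoord x := by
    have hcl : closure (halfSpace (n + 1)) ⊆ {x | 0 ≤ lastCoord x} :=
      closure_minimal (fun x (hx : 0 < lastCoord x) => hx.le)
        (isClosed_le continuous_const continuous_lastCoord)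
    rcases hΩ with ⟨-, rfl⟩ | ⟨-, rfl⟩
    · exact fun x hx => hcl hx
    · exact fun x hx => le_of_lt hx
  have hadm : ∀ k, IsCcOne Ω fun x => lastCoord x ^ (-a) * φ k x := fun k =>
    isCcOne_groundState_mul (halfSpace_subset_of_admissible hΩ) hΩ0 a (by positivity) hχs hρs
      hχout hρin
  have hPeq : ∀ k, hardyIntegral s p q α β (fun x => lastCoord x ^ (-a) * φ k x) = P k := by
    intro k
    refine setLIntegral_congr_fun measurableSet_halfSpace fun x hx => ?_
    have hx0 : 0 < lastCoord x := hx
    rw [abs_mul, abs_of_pos (by positivity), Real.mul_rpow (by positivity) (abs_nonneg _),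
      ← Real.rpow_mul hx0.le, div_eq_mul_inv, ← Real.rpow_neg hx0.le,
      show (-1 : ℝ) = -a * q + -(s * q - α - q * β / p) by rw [ha]; field_simp; ring,
      Real.rpow_add hx0]
    congr 1
    ring
  have hPfin : ∀ k, P k ≠ ∞ := fun k => by
    rw [← hPeq]
    exact hardyIntegral_ne_top hq0 hΩ (hadm k)
  set E : ℝ≥0∞ := tlSeminorm s p q α b χ ^ (1 / q) + M ^ (1 / q) with hE
  have hEfin : E ≠ ∞ := ENNReal.add_ne_top.2
    ⟨ENNReal.rpow_ne_top_of_nonneg (by positivity) hTχ,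
      ENNReal.rpow_ne_top_of_nonneg (by positivity) hM⟩
  have hmain : ∀ k, C ^ (1 / q) * P k ^ (1 / q)
      ≤ hardyConst (n + 1) s p q α β ^ (1 / q) * P k ^ (1 / q) + E := by
    intro k
    have h1 := hC _ (hadm k)
    rw [hPeq] at h1
    rw [← ENNReal.mul_rpow_of_nonneg _ _ (by positivity)]
    refine (ENNReal.rpow_le_rpow h1 (by positivity)).trans
      ((tlSeminorm_groundState_mul_le hs0 hq hpq ha (hφm k)).trans (add_le_add le_rfl ?_))
    refine (tlSeminorm_mul_le hp1 hq hbα hχm (by fun_prop)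
      (fun x => abs_le.2 ⟨by linarith [hχ0 x], hχ1 x⟩)
      (fun x => abs_le.2 ⟨by linarith [hρ1 (((k : ℝ) + 1) * lastCoord x)],
        by linarith [hρ0 (((k : ℝ) + 1) * lastCoord x)]⟩) hχout).trans (add_le_add le_rfl ?_)
    exact ENNReal.rpow_le_rpow (hvert _ (by positivity)) (by positivity)
  -- For each x the truncation is inactive once (k + 1) x_d ≥ 2, so Fatou bounds the divergent
  -- integral of |χ|^q / x_d by the supremum.
  have hPsup : ⨆ k, P k = ∞ := by
    rw [← top_le_iff, ← lintegral_halfSpace_inv_eq_top (q := q) (by norm_num : (0 : ℝ) < 1 / 2)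
      hχm hχin]
    calc _ = ∫⁻ x in halfSpace (n + 1), Filter.liminf
          (fun k => ENNReal.ofReal (|φ k x| ^ q * lastCoord x ^ (-1 : ℝ))) Filter.atTop := by
          refine setLIntegral_congr_fun measurableSet_halfSpace fun x hx => ?_
          have hx0 : 0 < lastCoord x := hx
          refine (Filter.Tendsto.liminf_eq ?_).symm
          refine tendsto_const_nhds.congr' ?_
          obtain ⟨N, hN⟩ := exists_nat_ge (2 / lastCoord x)
          filter_upwards [Filter.eventually_ge_atTop N] with k hk
          have hk' : (N : ℝ) ≤ k := Nat.cast_le.2 hk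
          have h2 : 2 ≤ ((k : ℝ) + 1) * lastCoord x :=
            (div_le_iff₀ hx0).1 (by linarith)
          simp only [hφ]
          rw [hρout _ (by rw [Real.norm_eq_abs]; exact h2.trans (le_abs_self _)), sub_zero, mul_one]
      _ ≤ Filter.liminf P Filter.atTop := lintegral_liminf_le fun k => by
          have := hφm k
          fun_prop
      _ ≤ _ := Filter.liminf_le_of_le (by isBoundedDefault) fun B hB => by
          obtain ⟨k, hk⟩ := hB.exists
          exact hk.trans (le_iSup P k)
  have hroot := le_of_forall_mul_le_mul_add hEfin
    (fun k => ENNReal.rpow_ne_top_of_nonneg (by positivity) (hPfin k)) hmain (by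
      by_contra hne
      have : ⨆ k, P k ≤ (⨆ k, P k ^ (1 / q)) ^ q := iSup_le fun k => by
        calc P k = (P k ^ (1 / q)) ^ q := by
              rw [← ENNReal.rpow_mul, one_div_mul_cancel hq0.ne', ENNReal.rpow_one]
          _ ≤ _ := ENNReal.rpow_le_rpow (le_iSup (fun k => P k ^ (1 / q)) k) hq0.le
      rw [hPsup, top_le_iff] at this
      exact ENNReal.rpow_ne_top_of_nonneg hq0.le hne this)
  exact (ENNReal.rpow_le_rpow_iff (by positivity : 0 < 1 / q)).1 hroot

end Sharpness

/-! ### Finiteness of the constant and conclusion. -/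

theorem hardyConst_lt_top (n : ℕ) {s p q α β : ℝ} (hs1 : s < 1) (hq : 1 ≤ q) (hpq : q ≤ p)
    (hα : α < s * q - (1 - q / p)) (hβ : β < s * p) (hα1 : -1 < α) (hβ1 : -1 < β) :
    hardyConst (n + 1) s p q α β < ∞ := by
  have hq0 : 0 < q := by linarith
  have hp0 : 0 < p := by linarith
  have hqp : 0 < q / p := by positivity
  rw [hardyConst_eq n hq0.ne' hp0.ne']
  set a := (1 + α + q * β / p - s * q) / q with ha
  have hbα : (s * p - (β - a * p)) * (q / p) = 1 + α := by
    rw [ha]; field_simp; ring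
  refine ENNReal.rpow_lt_top_of_nonneg hqp.le (ENNReal.mul_lt_top ENNReal.ofReal_lt_top ?_).ne
  -- The two remaining conditions say that β - ap lies in (-1, sp); they are the two bounds on α
  -- rewritten through `hbα`.
  refine profileIntegral_lt_top hs1 (hq.trans hpq) hβ1 hβ ?_ ?_
  · have h1 : (s * p - (β - a * p)) * (q / p) = s * q - (β - a * p) * (q / p) := by field_simp
    have h2 : 0 < (1 + (β - a * p)) * (q / p) := by linarith
    linarith [(pos_iff_pos_of_mul_pos h2).2 hqp]
  · by_contra h
    nlinarith

theorem theorem2 (d : ℕ) [NeZero d] (s p q α β : ℝ)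
    (hs0 : 0 < s) (hs1 : s < 1) (hq : 1 ≤ q) (hpq : q ≤ p)
    (hα : α < s * q - (1 - q / p)) (hβ : β < s * p)
    (hα1 : -1 < α) (hβ1 : -1 < β) (hαβ : -1 < α + q * β / p)
    (Ω : Set (EuclideanSpace ℝ (Fin d)))
    (hΩ : (s * q - α - q * β / p < 1 ∧ Ω = closure (halfSpace d)) ∨
      (1 < s * q - α - q * β / p ∧ Ω = halfSpace d)) :
    -- the constant is finite
    hardyConst d s p q α β < ∞ ∧
    -- the Hardy inequality
    (∀ u : EuclideanSpace ℝ (Fin d) → ℝ, IsCcOne Ω u →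
      hardyConst d s p q α β * hardyIntegral s p q α β u ≤ tlSeminorm s p q α β u) ∧
    -- sharpness of the constant
    (α < s * q - (1 - q / p) * d →
      ∀ C : ℝ≥0∞,
        (∀ u : EuclideanSpace ℝ (Fin d) → ℝ, IsCcOne Ω u →
          C * hardyIntegral s p q α β u ≤ tlSeminorm s p q α β u) →
        C ≤ hardyConst d s p q α β) := by
  obtain ⟨n, rfl⟩ : ∃ n, d = n + 1 := Nat.exists_eq_succ_of_ne_zero (NeZero.ne d)
  exact ⟨hardyConst_lt_top n hs1 hq hpq hα hβ hα1 hβ1,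
    fun u hu => hardyConst_mul_le_tlSeminorm hs0 hq hpq hΩ hu,
    fun hαd C hC => le_hardyConst_of_forall hs0 hs1 hq hpq hα hα1 hαd hΩ hC⟩
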